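/- Let $n\in\mathbb N$, let $D_{ij}=D_{ji}>0$ ($i\neq j$, $1\le i,j\le n$), and let $\mathbb T^3=\mathbb R^3/\mathbb Z^3$. Let $c^0=(c_1^0,\dots,c_n^0)$ be measurable on $\mathbb T^3$ with $c^0_i\ge 0$ and $\sum_i c_i^0=1$ almost everywhere. A pair $(\mathbf c,\mathbf u)$, with $c_i:\mathbb T^3\times(0,\infty)\to\mathbb R$ measurable and $u_i:\mathbb T^3\times(0,\infty)\to\mathbb R^3$, is called a renormalized solution of the Maxwell–Stefan system with initial data $c^0$ if for every $i$: (i) $0\le c_i\le 1$ and $\sum_{j} c_j=1$ almost everywhere; (ii) the weak gradient $\nabla\sqrt{c_i}$ exists, and $\nabla\sqrt{c_i}$ and $\sqrt{c_i}\,u_i$ belong to $L^2(\mathbb T^3\times(0,T))$ for every $T>0$; (iii) for all $\beta\in C^2([0,\infty))$ and $\phi\in C_c^\infty(\mathbb T^3\times[0,\infty))$, $$\int_{\mathbb T^3}\beta(c_i^0)\phi(x,0)\,dx+\int_0^\infty\!\!\int_{\mathbb T^3}\Big(\beta(c_i)\,\partial_t\phi+\sqrt{c_i}\,\beta'(c_i)\,\sqrt{c_i}u_i\cdot\nabla\phi+2c_i\beta''(c_i)\,\nabla\sqrt{c_i}\cdot\sqrt{c_i}u_i\,\phi\Big)dx\,dt=0,$$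 and the fluxes $J_i=c_iu_i$ satisfy $\nabla c_i=-\sum_{j\ne i}\frac{c_jJ_i-c_iJ_j}{D_{ij}}$ (weak gradient) and $\sum_{j}J_j=0$ almost everywhere; (iv) $\displaystyle\lim_{t\to0}\int_{\mathbb T^3}|\beta(c_i(x,t))-\beta(c_i^0(x))|\,dx=0$ for all $\beta\in C([0,\infty))$, as an essential limit (null sets of times $t$ are disregarded). Theorem. Let $(\mathbf c,\mathbf u)$ and $(\bar{\mathbf c},\bar{\mathbf u})$ be two renormalized solutions with the same coefficients $D_{ij}$ and the same initial data $c^0$. Then all $c_i$ and $\bar c_i$ have a representative in $C([0,\infty);L^2(\mathbb T^3))$, which is used to evaluate them at a fixed time. For every $\beta\in C^2([0,\infty))$, the functions $\beta(c_i)-\beta(\bar c_i)$, $(c_i-\bar c_i)\beta'(c_i)$ and $(c_i-\bar c_i)\beta'(\bar c_i)$ have weak gradients with respect to $x$ on $\mathbb T^3\times(0,\infty)$, and for every $T>0$ all integrands below are integrable and $$\begin{aligned}\sum_{i=1}^n\int_{\mathbb T^3}\big(\beta(c_i)-\beta(\bar c_i)\big)(c_i-\bar c_i)\,dx\,\Big|_{t=T}={}&\sum_{i=1}^n\int_0^T\!\!\int_{\mathbb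 T^3}\nabla\big(\beta(c_i)-\beta(\bar c_i)\big)\cdot(c_iu_i-\bar c_i\bar u_i)\,dx\,dt\\&+\sum_{i=1}^n\int_0^T\!\!\int_{\mathbb T^3}\Big(\nabla\big[(c_i-\bar c_i)\beta'(c_i)\big]\cdot c_iu_i-\nabla\big[(c_i-\bar c_i)\beta'(\bar c_i)\big]\cdot\bar c_i\bar u_i\Big)dx\,dt.\end{aligned}$$ -/

import Mathlib

open MeasureTheory Set Filter Topology
open scoped ContDiff

noncomputable section

namespace MaxwellStefan

/-- The three-dimensional torus `(ℝ/ℤ)³`, with its (product) Lebesgue measure `volume`. -/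
abbrev T3 : Type := Fin 3 → UnitAddCircle

/-- Three-dimensional Euclidean space, in which gradients, velocities and fluxes take values. -/
abbrev E3 : Type := EuclideanSpace ℝ (Fin 3)

/-- The space-time cylinder `(0,∞) × 𝕋³`; time is the first coordinate. -/
abbrev cyl : Set (ℝ × T3) := Ioi 0 ×ˢ univ

/-- The bounded space-time cylinder `(0,T) × 𝕋³`. -/
abbrev cylUpTo (T : ℝ) : Set (ℝ × T3) := Ioo 0 T ×ˢ univ

/-- The classical gradient of a function on the torus: the `k`-th component is the derivative
along the `k`-th coordinate circle. -/
def torusGrad (f : T3 → ℝ) (x : T3) : E3 :=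
  WithLp.toLp 2 fun k => deriv (fun s : ℝ => f (x + Pi.single k (s : UnitAddCircle))) 0

/-- The classical spatial gradient `∇φ(t,x)` of a function on space-time. -/
def spaceGrad (φ : ℝ × T3 → ℝ) (p : ℝ × T3) : E3 :=
  torusGrad (fun x => φ (p.1, x)) p.2

/-- The classical time derivative `∂ₜφ(t,x)`. -/
def timeDeriv (φ : ℝ × T3 → ℝ) (p : ℝ × T3) : ℝ :=
  deriv (fun s => φ (s, p.2)) p.1

/-- `φ ∈ C_c^∞(ℝ × 𝕋³)`: smooth as a function that is `ℤ³`-periodic in space, with compact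
support. The restrictions of these functions to `t ≥ 0` are the elements of
`C_c^∞(𝕋³ × [0,∞))`. -/
structure IsTestFunction (φ : ℝ × T3 → ℝ) : Prop where
  smooth : ContDiff ℝ ∞
    (fun p : ℝ × (Fin 3 → ℝ) => φ (p.1, fun k => (p.2 k : UnitAddCircle)))
  compact_support : HasCompactSupport φ

/-- `g` is the distributional (weak) spatial gradient of `f` on `(0,∞) × 𝕋³`. -/
structure IsWeakGrad (f : ℝ × T3 → ℝ) (g : ℝ × T3 → E3) : Prop where
  locInt : LocallyIntegrableOn f cyl volume
  locInt_grad : LocallyIntegrableOn g cyl volume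
  integral_eq : ∀ φ : ℝ × T3 → ℝ, IsTestFunction φ → tsupport φ ⊆ cyl → ∀ k : Fin 3,
    ∫ p in cyl, f p * spaceGrad φ p k = - ∫ p in cyl, g p k * φ p

/-- The diffusion coefficients: `D i j = D j i > 0` for `i ≠ j`. -/
def IsDiffusionMatrix {n : ℕ} (D : Fin n → Fin n → ℝ) : Prop :=
  ∀ i j, i ≠ j → 0 < D i j ∧ D i j = D j i

/-- Admissible initial concentrations: nonnegative (measurable) with sum one. They take values in
`[0,1]`, so they are in `L^∞` and have finite entropy. -/
structure IsInitialDatum {n : ℕ} (c₀ : Fin n → T3 → ℝ) : Prop where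
  meas : ∀ i, AEStronglyMeasurable (c₀ i) volume
  nonneg : ∀ i, ∀ᵐ x, 0 ≤ c₀ i x
  sum_eq_one : ∀ᵐ x, ∑ i, c₀ i x = 1

/-- `c` (concentrations), with velocities `u` and with `g i = ∇√(c i)`, is a renormalized solution
of the Maxwell–Stefan system with diffusion coefficients `D` and initial concentrations `c₀`.
The molar flux is `J i = c i • u i`. -/
structure IsRenormalizedSolutionWith {n : ℕ} (D : Fin n → Fin n → ℝ) (c₀ : Fin n → T3 → ℝ)
    (c : Fin n → ℝ × T3 → ℝ) (u g : Fin n → ℝ × T3 → E3) : Prop where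
  meas : ∀ i, AEStronglyMeasurable (c i) (volume.restrict cyl)
  bounds : ∀ i, ∀ᵐ p ∂(volume.restrict cyl), 0 ≤ c i p ∧ c i p ≤ 1
  sum_eq_one : ∀ᵐ p ∂(volume.restrict cyl), ∑ i, c i p = 1
  grad_sqrt : ∀ i, IsWeakGrad (fun p => √(c i p)) (g i)
  grad_sqrt_L2 : ∀ i, ∀ T > 0, MemLp (g i) 2 (volume.restrict (cylUpTo T))
  sqrt_vel_L2 : ∀ i, ∀ T > 0,
    MemLp (fun p => √(c i p) • u i p) 2 (volume.restrict (cylUpTo T))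
  /-- The renormalized equation, including the initial condition. -/
  renormalized : ∀ i, ∀ β : ℝ → ℝ, ContDiffOn ℝ 2 β (Ici 0) →
    ∀ φ : ℝ × T3 → ℝ, IsTestFunction φ →
      (∫ x, β (c₀ i x) * φ (0, x))
        + (∫ p in cyl, β (c i p) * timeDeriv φ p)
        + (∫ p in cyl, √(c i p) * derivWithin β (Ici 0) (c i p)
            * inner ℝ (√(c i p) • u i p) (spaceGrad φ p))
        + 2 * (∫ p in cyl, c i p * iteratedDerivWithin 2 β (Ici 0) (c i p)
            * inner ℝ (g i p) (√(c i p) • u i p) * φ p) = 0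
  /-- The force-flux relations `∇cᵢ = - ∑_{j ≠ i} (cⱼ Jᵢ - cᵢ Jⱼ) / Dᵢⱼ`. -/
  force_flux : ∀ i, IsWeakGrad (c i) (fun p =>
    - ∑ j ∈ Finset.univ.erase i,
        (D i j)⁻¹ • (c j p • (c i p • u i p) - c i p • (c j p • u j p)))
  /-- The constraint `∑ Jᵢ = 0`. -/
  flux_sum : ∀ᵐ p ∂(volume.restrict cyl), ∑ i, c i p • u i p = 0
  /-- Attainment of the initial data; `t → 0` avoids null sets of times, so that the condition
  does not depend on the representative of `c`. -/
  initial : ∀ i, ∀ β : ℝ → ℝ, ContinuousOn β (Ici 0) →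
    Tendsto (fun t : ℝ => ∫ x, |β (c i (t, x)) - β (c₀ i x)|) (𝓝[>] 0 ⊓ ae volume) (𝓝 0)

/-- `c`, with velocities `u`, is a renormalized solution of the Maxwell–Stefan system. -/
def IsRenormalizedSolution {n : ℕ} (D : Fin n → Fin n → ℝ) (c₀ : Fin n → T3 → ℝ)
    (c : Fin n → ℝ × T3 → ℝ) (u : Fin n → ℝ × T3 → E3) : Prop :=
  ∃ g : Fin n → ℝ × T3 → E3, IsRenormalizedSolutionWith D c₀ c u g

/-- `F ∈ C([0,∞); L²(𝕋³))` is the time-continuous version of `f`: `F t = f(t,·)` in `L²(𝕋³)` for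
almost every `t > 0`. It gives a meaning to `f` at every single time `t ≥ 0`. -/
def IsContinuousVersion (f : ℝ × T3 → ℝ) (F : ℝ → Lp ℝ 2 (volume : Measure T3)) : Prop :=
  ContinuousOn F (Ici 0) ∧
    ∀ᵐ t ∂(volume.restrict (Ioi (0 : ℝ))), ∀ᵐ x, F t x = f (t, x)

end MaxwellStefan

end

open MaxwellStefan

noncomputable section

namespace MaxwellStefan

/-! ### Calculus on the torus -/

/-! The identity holds species by species, because each concentration is by itself a weak solution
of a linear transport equation. Choosing `β(s) = s` in the renormalized equation gives `∂ₜc + div J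
= 0` with initial value `c₀`, where `J = c u`. Since `0 ≤ c ≤ 1` and `√c u ∈ L²`, the flux `J` is in
`L²` on bounded cylinders, and the force-flux relation puts `∇c` there too
(`exists_isWeakSolution`).

For such solutions the formal computation can be justified by mollifying in space only. At a fixed
point `x`, the mollified concentration is almost everywhere in time the indefinite integral of `-div
(ρ * J)` started at `ρ * c₀` (`ae_stconv_eq_mollSol`). It is therefore absolutely continuous in
time, and the ordinary chain rule applies to `F(c, c')` for a `C²` function `F` of two variables.
Integrating over the torus and by parts in space gives `energy_mollSol`, whose right-hand side
contains only `∇c`, `∇c'`, `J`, `J'` and bounded coefficients. The mollifications of these four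
converge strongly in `L²`, and multiplication by continuous functions of the concentrations
preserves this convergence (`TendstoL2.comp_mul`), so the mollifier can be removed:
`energy_weakSolution`, and in the same way the chain rule `isWeakGrad_comp`.

Continuity in time comes from the same identity, with `F(a, b) = (a - b)²` applied to two
mollifications of one solution: they form a Cauchy sequence in `L²`, uniformly on bounded time
intervals (`exists_continuousVersion`).

The theorem is the case `F(a, b) = (β(a) - β(b)) (a - b)`. Its partial derivatives are `(a - b)
β'(a) + (β(a) - β(b))` and `-((a - b) β'(b) + (β(a) - β(b)))`, whose gradients are those in the
statement; they are `C¹` exactly because `β` is `C²`. The initial term vanishes since `F` is zero on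
the diagonal and the two solutions share `c₀` (`energy_species`). -/

instance isProbabilityMeasure_circle : IsProbabilityMeasure (volume : Measure UnitAddCircle) :=
  ⟨by simp [AddCircle.measure_univ]⟩

instance isProbabilityMeasure_torus : IsProbabilityMeasure (volume : Measure T3) := by
  show IsProbabilityMeasure (Measure.pi fun _ => (volume : Measure UnitAddCircle))
  infer_instance

instance isNegInvariant_torus : (volume : Measure T3).IsNegInvariant :=
  Measure.pi.isNegInvariant _

/-- The covering map `ℝ³ → 𝕋³`. -/
def torusMk (y : Fin 3 → ℝ) : T3 := fun k => (y k : UnitAddCircle)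

/-- Smoothness of test functions is expressed on periodic lifts; the quotient property brings
continuity back to the torus. -/
theorem isOpenQuotientMap_torusMk : IsOpenQuotientMap torusMk :=
  IsOpenQuotientMap.piMap fun _ => QuotientAddGroup.isOpenQuotientMap_mk

theorem torusMk_add_single (y : Fin 3 → ℝ) (k : Fin 3) (s : ℝ) :
    torusMk (y + Pi.single k s) = torusMk y + Pi.single k (s : UnitAddCircle) := by
  ext i
  by_cases h : i = k
  · subst h; simp [torusMk]
  · simp [torusMk, h]

theorem torusMk_sub (y z : Fin 3 → ℝ) : torusMk (y - z) = torusMk y - torusMk z := by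
  ext i; simp [torusMk]

/-- `f'` is the classical derivative of `f` along the `k`-th coordinate circle. -/
def HasTorusDeriv (k : Fin 3) (f f' : T3 → ℝ) : Prop :=
  ∀ x, HasDerivAt (fun s : ℝ => f (x + Pi.single k (s : UnitAddCircle))) (f' x) 0

theorem single_coe_add (k : Fin 3) (s r : ℝ) :
    (Pi.single k ((s + r : ℝ) : UnitAddCircle) : T3)
      = Pi.single k (s : UnitAddCircle) + Pi.single k (r : UnitAddCircle) := by
  rw [← Pi.single_add]; simp

theorem continuous_single_coe (k : Fin 3) :
    Continuous fun s : ℝ => (Pi.single k (s : UnitAddCircle) : T3) :=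
  (continuous_single (A := fun _ : Fin 3 => UnitAddCircle) k).comp (AddCircle.continuous_mk' 1)

namespace HasTorusDeriv

variable {k : Fin 3} {f f' g g' : T3 → ℝ}

theorem torusGrad_eq (h : HasTorusDeriv k f f') (x : T3) : torusGrad f x k = f' x := by
  simpa [torusGrad] using (h x).deriv

/-- The definition differentiates only at parameter `0`, but at every base point; moving the base
point along the circle reaches every parameter. -/
theorem hasDerivAt (h : HasTorusDeriv k f f') (x : T3) (s : ℝ) :
    HasDerivAt (fun r : ℝ => f (x + Pi.single k (r : UnitAddCircle)))
      (f' (x + Pi.single k (s : UnitAddCircle))) s := by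
  have h1 := h (x + Pi.single k (s : UnitAddCircle))
  have h2 : HasDerivAt (fun r : ℝ => r - s) 1 s := (hasDerivAt_id s).sub_const s
  have h3 := HasDerivAt.comp (h := fun r : ℝ => r - s) s (by simpa using h1) h2
  simp only [mul_one] at h3
  refine h3.congr_of_eventuallyEq (Eventually.of_forall fun r => ?_)
  simp only [Function.comp_def, add_assoc, ← single_coe_add]
  simp

theorem mul (h : HasTorusDeriv k f f') (h' : HasTorusDeriv k g g') :
    HasTorusDeriv k (fun x => f x * g x) (fun x => f' x * g x + f x * g' x) := by
  intro x
  simpa using (h x).fun_mul (h' x)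

/-- Along one turn of the circle the derivative integrates to zero, as both endpoints are the same
point. Averaging over all base points and exchanging the integrals, translation invariance leaves
just the integral of `f'`. -/
theorem integral_eq_zero (h : HasTorusDeriv k f f') (hf' : Continuous f') : ∫ x, f' x = 0 := by
  have key : ∀ x : T3, ∫ s in (0 : ℝ)..1, f' (x + Pi.single k (s : UnitAddCircle)) = 0 := by
    intro x
    rw [intervalIntegral.integral_eq_sub_of_hasDerivAt (fun s _ => h.hasDerivAt x s)]
    · have h1 : ((1 : ℝ) : UnitAddCircle) = 0 := AddCircle.coe_period 1
      simp [h1]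
    · exact (hf'.comp (continuous_const.add (continuous_single_coe k))).intervalIntegrable _ _
  have hsw : ∫ x : T3, ∫ s in (0 : ℝ)..1, f' (x + Pi.single k (s : UnitAddCircle))
      = ∫ s in (0 : ℝ)..1, ∫ x : T3, f' (x + Pi.single k (s : UnitAddCircle)) := by
    simp only [intervalIntegral.integral_of_le zero_le_one]
    apply integral_integral_swap
    obtain ⟨C, hC⟩ := isCompact_univ.exists_bound_of_continuousOn hf'.continuousOn
    refine Integrable.of_bound (C := C) ?_ (Eventually.of_forall fun p => hC _ trivial)
    exact (hf'.comp (continuous_fst.add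
      ((continuous_single_coe k).comp continuous_snd))).aestronglyMeasurable
  simp only [key, integral_zero, integral_add_right_eq_self (fun x => f' x)] at hsw
  simpa using hsw.symm

theorem integral_mul_eq (h : HasTorusDeriv k f f') (h' : HasTorusDeriv k g g')
    (hf : Continuous f) (hf' : Continuous f') (hg : Continuous g) (hg' : Continuous g') :
    ∫ x, f x * g' x = - ∫ x, f' x * g x := by
  have := (h.mul h').integral_eq_zero (by fun_prop)
  rw [integral_add ((by fun_prop : Continuous fun x => f' x * g x).integrable_of_hasCompactSupport
    (.of_compactSpace _)) ((by fun_prop : Continuous fun x =>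
      f x * g' x).integrable_of_hasCompactSupport (.of_compactSpace _))] at this
  linarith

end HasTorusDeriv

/-- `Φ₁` and `Φ₂` are the partial derivatives of the continuously differentiable function `Φ`
of two variables. -/
structure HasPartials (Φ Φ₁ Φ₂ : ℝ × ℝ → ℝ) : Prop where
  hasFDerivAt : ∀ z, HasFDerivAt Φ
    (Φ₁ z • ContinuousLinearMap.fst ℝ ℝ ℝ + Φ₂ z • ContinuousLinearMap.snd ℝ ℝ ℝ) z
  continuous_fst : Continuous Φ₁
  continuous_snd : Continuous Φ₂

namespace HasPartials

variable {Φ Φ₁ Φ₂ : ℝ × ℝ → ℝ}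

theorem continuous (h : HasPartials Φ Φ₁ Φ₂) : Continuous Φ :=
  continuous_iff_continuousAt.2 fun z => (h.hasFDerivAt z).continuousAt

theorem hasDerivAt_comp (h : HasPartials Φ Φ₁ Φ₂) {a b : ℝ → ℝ} {a' b' s : ℝ}
    (ha : HasDerivAt a a' s) (hb : HasDerivAt b b' s) :
    HasDerivAt (fun r => Φ (a r, b r)) (Φ₁ (a s, b s) * a' + Φ₂ (a s, b s) * b') s := by
  simpa [Function.comp_def] using (h.hasFDerivAt (a s, b s)).comp_hasDerivAt s (ha.prodMk hb)

theorem hasTorusDeriv (h : HasPartials Φ Φ₁ Φ₂) {k : Fin 3} {a a' b b' : T3 → ℝ}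
    (ha : HasTorusDeriv k a a') (hb : HasTorusDeriv k b b') :
    HasTorusDeriv k (fun x => Φ (a x, b x))
      (fun x => Φ₁ (a x, b x) * a' x + Φ₂ (a x, b x) * b' x) := by
  intro x
  have := h.hasDerivAt_comp (ha x) (hb x)
  simpa using this

end HasPartials

/-! ### Derivatives of functions with a smooth periodic lift. -/

section Smooth

variable {φ : ℝ × T3 → ℝ}

theorem continuous_of_lift {Y : Type*} [TopologicalSpace Y] {f : ℝ × T3 → Y}
    (h : Continuous fun p : ℝ × (Fin 3 → ℝ) => f (p.1, torusMk p.2)) : Continuous f :=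
  (IsOpenQuotientMap.id.prodMap isOpenQuotientMap_torusMk).isQuotientMap.continuous_iff.2 h

theorem hasDerivAt_lift
    (h : ContDiff ℝ ∞ fun p : ℝ × (Fin 3 → ℝ) => φ (p.1, torusMk p.2)) (k : Fin 3)
    (t : ℝ) (y : Fin 3 → ℝ) :
    HasDerivAt (fun s : ℝ => φ (t, torusMk y + Pi.single k (s : UnitAddCircle)))
      (fderiv ℝ (fun p : ℝ × (Fin 3 → ℝ) => φ (p.1, torusMk p.2)) (t, y) (0, Pi.single k 1)) 0 := by
  have h1 : HasDerivAt (fun s : ℝ => ((t, y + Pi.single k s) : ℝ × (Fin 3 → ℝ)))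
      (0, Pi.single k 1) 0 := by
    refine (hasDerivAt_const _ _).prodMk ?_
    simpa using ((ContinuousLinearMap.single ℝ (fun _ : Fin 3 => ℝ) k).hasDerivAt
      (x := (0 : ℝ))).const_add y
  have h2 := ((h.differentiable (by simp)) (t, y + Pi.single k (0 : ℝ))).hasFDerivAt
  have := h2.comp_hasDerivAt (0 : ℝ) h1
  simpa [torusMk_add_single, Function.comp_def] using this

theorem hasTorusDeriv_spaceGrad
    (h : ContDiff ℝ ∞ fun p : ℝ × (Fin 3 → ℝ) => φ (p.1, torusMk p.2)) (k : Fin 3) (t : ℝ) :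
    HasTorusDeriv k (fun x => φ (t, x)) (fun x => spaceGrad φ (t, x) k) := by
  intro x
  obtain ⟨y, rfl⟩ := isOpenQuotientMap_torusMk.surjective x
  have := hasDerivAt_lift h k t y
  have e : spaceGrad φ (t, torusMk y) k = _ := this.deriv
  simp only [e]
  exact this

theorem continuous_spaceGrad
    (h : ContDiff ℝ ∞ fun p : ℝ × (Fin 3 → ℝ) => φ (p.1, torusMk p.2)) (k : Fin 3) :
    Continuous fun p => spaceGrad φ p k := by
  apply continuous_of_lift
  have e : ∀ p : ℝ × (Fin 3 → ℝ), spaceGrad φ (p.1, torusMk p.2) k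
      = fderiv ℝ (fun p : ℝ × (Fin 3 → ℝ) => φ (p.1, torusMk p.2)) p (0, Pi.single k 1) :=
    fun p => (hasDerivAt_lift h k p.1 p.2).deriv
  simp only [e]
  exact (h.continuous_fderiv (by simp)).clm_apply continuous_const

end Smooth

/-! ### Mollification on the torus -/

/-- The convolution of `ρ` and `f` on the torus. -/
def tconv (ρ f : T3 → ℝ) (x : T3) : ℝ := ∫ y, ρ (x - y) * f y

theorem exists_bound_torus {f : T3 → ℝ} (hf : Continuous f) : ∃ C, 0 ≤ C ∧ ∀ x, |f x| ≤ C := by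
  obtain ⟨C, hC⟩ := isCompact_univ.exists_bound_of_continuousOn hf.continuousOn
  exact ⟨C, (norm_nonneg _).trans (hC 0 trivial), fun x => hC x trivial⟩

theorem integrable_tconv_integrand {ρ f : T3 → ℝ} (hρ : Continuous ρ) (hf : Integrable f)
    (x : T3) : Integrable fun y => ρ (x - y) * f y := by
  obtain ⟨C, -, hC⟩ := exists_bound_torus hρ
  exact hf.bdd_mul (c := C) (by fun_prop : Continuous fun y => ρ (x - y)).aestronglyMeasurable
    (Eventually.of_forall fun y => hC _)

theorem continuous_tconv {ρ f : T3 → ℝ} (hρ : Continuous ρ) (hf : Integrable f) :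
    Continuous (tconv ρ f) := by
  obtain ⟨C, -, hC⟩ := exists_bound_torus hρ
  refine continuous_of_dominated (bound := fun y => C * ‖f y‖)
    (fun x => (integrable_tconv_integrand hρ hf x).aestronglyMeasurable)
    (fun x => Eventually.of_forall fun y => ?_) (hf.norm.const_mul C)
    (Eventually.of_forall fun y => by fun_prop)
  rw [norm_mul]
  exact mul_le_mul_of_nonneg_right (hC _) (norm_nonneg _)

theorem HasTorusDeriv.tconv {k : Fin 3} {ρ ρ' f : T3 → ℝ} (h : HasTorusDeriv k ρ ρ')
    (hρ : Continuous ρ) (hρ' : Continuous ρ') (hf : Integrable f) :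
    HasTorusDeriv k (tconv ρ f) (tconv ρ' f) := by
  intro x
  obtain ⟨C, -, hC⟩ := exists_bound_torus hρ'
  have := (hasDerivAt_integral_of_dominated_loc_of_deriv_le (μ := (volume : Measure T3))
    (F := fun (s : ℝ) y => ρ (x + Pi.single k (s : UnitAddCircle) - y) * f y)
    (F' := fun (s : ℝ) y => ρ' (x + Pi.single k (s : UnitAddCircle) - y) * f y)
    (x₀ := (0 : ℝ)) (s := univ) (bound := fun y => C * ‖f y‖) univ_mem
    (Eventually.of_forall fun s => (integrable_tconv_integrand hρ hf _).aestronglyMeasurable)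
    (integrable_tconv_integrand hρ hf _)
    (integrable_tconv_integrand hρ' hf _).aestronglyMeasurable
    (Eventually.of_forall fun y s _ => ?_) (hf.norm.const_mul C)
    (Eventually.of_forall fun y s _ => ?_)).2
  · simpa [MaxwellStefan.tconv] using this
  · rw [norm_mul]
    exact mul_le_mul_of_nonneg_right (hC _) (norm_nonneg _)
  · have := (h.hasDerivAt (x - y) s).mul_const (f y)
    simpa only [add_sub_right_comm] using this

theorem tconv_eq_integral_sub (ρ f : T3 → ℝ) (x : T3) :
    tconv ρ f x = ∫ y, ρ y * f (x - y) := by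
  rw [tconv, ← integral_sub_left_eq_self _ volume x]
  simp

/-! ### `L²` theory of mollification on the torus -/

/-- A smooth probability density on the torus. -/
structure IsMollifier (ρ : T3 → ℝ) : Prop where
  smooth : ContDiff ℝ ∞ fun y : Fin 3 → ℝ => ρ (torusMk y)
  nonneg : ∀ x, 0 ≤ ρ x
  integral_eq_one : ∫ x, ρ x = 1

namespace IsMollifier

variable {ρ : T3 → ℝ}

theorem smooth_lift (h : IsMollifier ρ) :
    ContDiff ℝ ∞ fun p : ℝ × (Fin 3 → ℝ) => (fun q : ℝ × T3 => ρ q.2) (p.1, torusMk p.2) :=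
  h.smooth.comp contDiff_snd

theorem continuous (h : IsMollifier ρ) : Continuous ρ :=
  (continuous_of_lift (f := fun q : ℝ × T3 => ρ q.2) h.smooth_lift.continuous).comp
    (continuous_const.prodMk continuous_id : Continuous fun x : T3 => ((0 : ℝ), x))

theorem hasTorusDeriv (h : IsMollifier ρ) (k : Fin 3) :
    HasTorusDeriv k ρ (fun x => torusGrad ρ x k) :=
  hasTorusDeriv_spaceGrad (φ := fun q : ℝ × T3 => ρ q.2) h.smooth_lift k 0

theorem continuous_torusGrad (h : IsMollifier ρ) (k : Fin 3) :
    Continuous fun x => torusGrad ρ x k :=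
  (continuous_spaceGrad (φ := fun q : ℝ × T3 => ρ q.2) h.smooth_lift k).comp
    (continuous_const.prodMk continuous_id : Continuous fun x : T3 => ((0 : ℝ), x))

theorem integrable (h : IsMollifier ρ) : Integrable ρ :=
  h.continuous.integrable_of_hasCompactSupport (.of_compactSpace _)

theorem tconv_mem_Icc (h : IsMollifier ρ) {f : T3 → ℝ} (hf : AEStronglyMeasurable f volume)
    (hf01 : ∀ x, f x ∈ Icc (0 : ℝ) 1) (x : T3) : tconv ρ f x ∈ Icc (0 : ℝ) 1 := by
  have hfi : Integrable f := Integrable.of_bound (C := 1) hf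
    (Eventually.of_forall fun x => by
      rw [Real.norm_eq_abs, abs_of_nonneg (hf01 x).1]; exact (hf01 x).2)
  refine ⟨integral_nonneg fun y => mul_nonneg (h.nonneg _) (hf01 y).1, ?_⟩
  calc tconv ρ f x ≤ ∫ y, ρ (x - y) :=
        integral_mono (integrable_tconv_integrand h.continuous hfi x)
          (h.integrable.comp_sub_left x)
          fun y => mul_le_of_le_one_right (h.nonneg _) (hf01 y).2
    _ = 1 := by rw [integral_sub_left_eq_self ρ volume x, h.integral_eq_one]

/-- Jensen's inequality for the probability density `ρ`, read off from the nonnegativity of the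
variance of `g`. -/
theorem sq_integral_mul_le (h : IsMollifier ρ) {g : T3 → ℝ} (hg : MemLp g 2 volume) :
    (∫ y, ρ y * g y) ^ 2 ≤ ∫ y, ρ y * g y ^ 2 := by
  obtain ⟨C, -, hC⟩ := exists_bound_torus h.continuous
  have hm := h.continuous.aestronglyMeasurable (μ := (volume : Measure T3))
  have h1 : Integrable fun y => ρ y * g y :=
    (hg.integrable one_le_two).bdd_mul (c := C) hm (Eventually.of_forall fun y => hC y)
  have h2 : Integrable fun y => ρ y * g y ^ 2 :=
    hg.integrable_sq.bdd_mul (c := C) hm (Eventually.of_forall fun y => hC y)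
  set m := ∫ y, ρ y * g y
  have h3 : 0 ≤ ∫ y, ρ y * (g y - m) ^ 2 :=
    integral_nonneg fun y => mul_nonneg (h.nonneg _) (sq_nonneg _)
  have h4 : ∫ y, ρ y * (g y - m) ^ 2
      = ∫ y, (ρ y * g y ^ 2 - 2 * m * (ρ y * g y) + m ^ 2 * ρ y) :=
    integral_congr_ae (Eventually.of_forall fun y => by ring)
  have h5 : Integrable fun y => ρ y * g y ^ 2 - 2 * m * (ρ y * g y) := h2.sub (h1.const_mul _)
  rw [h4, integral_add h5 (h.integrable.const_mul _),
    integral_sub h2 (h1.const_mul _), integral_const_mul, integral_const_mul,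
    h.integral_eq_one] at h3
  change 0 ≤ _ - 2 * m * m + _ at h3
  nlinarith

end IsMollifier

/-- The squared `L²`-distance between `f` and its translate by `-y`. -/
def translationDefect (f : T3 → ℝ) (y : T3) : ℝ :=
  ∫ x, (f (x - y) - f x) ^ 2

theorem memLp_comp_sub {f : T3 → ℝ} (hf : MemLp f 2 volume) (y : T3) :
    MemLp (fun x => f (x - y)) 2 volume :=
  hf.comp_measurePreserving (measurePreserving_sub_right volume y)

theorem memLp_comp_sub_left {f : T3 → ℝ} (hf : MemLp f 2 volume) (y : T3) :
    MemLp (fun x => f (y - x)) 2 volume :=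
  hf.comp_measurePreserving (Measure.measurePreserving_sub_left volume y)

theorem integral_sq_eq_norm_sq {α : Type*} [MeasurableSpace α] {μ : Measure α} {f : α → ℝ}
    (hf : MemLp f 2 μ) : ∫ x, f x ^ 2 ∂μ = ‖hf.toLp f‖ ^ 2 := by
  rw [← real_inner_self_eq_norm_sq, L2.inner_def]
  refine integral_congr_ae ?_
  filter_upwards [hf.coeFn_toLp] with x hx
  rw [hx]
  simp [sq]

/-- Translations act continuously on `L²`; convergence of mollifications rests on this. -/
theorem continuous_translationDefect {f : T3 → ℝ} (hf : MemLp f 2 volume) :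
    Continuous (translationDefect f) := by
  have key : ∀ y, translationDefect f y
      = ‖Lp.compMeasurePreserving (fun x => x - y) (measurePreserving_sub_right volume y)
          (hf.toLp f) - hf.toLp f‖ ^ 2 := by
    intro y
    have h2 := integral_sq_eq_norm_sq ((memLp_comp_sub hf y).sub hf)
    rw [MemLp.toLp_sub (memLp_comp_sub hf y) hf] at h2
    rw [Lp.toLp_compMeasurePreserving hf]
    exact h2
  rw [funext key]
  have hc : Continuous fun y : T3 => Lp.compMeasurePreserving (fun x => x - y)
      (measurePreserving_sub_right volume y) (hf.toLp f) :=
    Continuous.compMeasurePreservingLp (g := fun y => ⟨fun x => x - y, by fun_prop⟩)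
      continuous_const (ContinuousMap.continuous_of_continuous_uncurry _
        (continuous_snd.sub continuous_fst))
      (fun y => measurePreserving_sub_right volume y) ENNReal.ofNat_ne_top
  fun_prop

theorem translationDefect_zero (f : T3 → ℝ) : translationDefect f 0 = 0 := by
  simp [translationDefect]

namespace IsMollifier

variable {ρ : T3 → ℝ}

theorem integrable_conv_integrand (h : IsMollifier ρ) {g : T3 → ℝ} (hg : Integrable g) :
    Integrable (fun p : T3 × T3 => ρ p.2 * g (p.1 - p.2)) (volume.prod volume) :=
  h.integrable.convolution_integrand (ContinuousLinearMap.mul ℝ ℝ) hg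

theorem tconv_sub_sq_le (h : IsMollifier ρ) {f : T3 → ℝ} (hf : MemLp f 2 volume) (x : T3) :
    (tconv ρ f x - f x) ^ 2 ≤ ∫ y, ρ y * (f (x - y) - f x) ^ 2 := by
  have h1 := memLp_comp_sub_left hf x
  have h2 : MemLp (fun y => f (x - y) - f x) 2 volume := h1.sub (memLp_const (f x))
  refine le_trans (le_of_eq ?_) (h.sq_integral_mul_le h2)
  congr 1
  have h3 : Integrable fun y => ρ y * f (x - y) := by
    obtain ⟨C, -, hC⟩ := exists_bound_torus h.continuous
    exact (h1.integrable one_le_two).bdd_mul (c := C) h.continuous.aestronglyMeasurable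
      (Eventually.of_forall fun y => hC y)
  simp only [mul_sub]
  rw [integral_sub h3 (h.integrable.mul_const _), integral_mul_const, h.integral_eq_one,
    tconv_eq_integral_sub, one_mul]

theorem tconv_sq_le (h : IsMollifier ρ) {f : T3 → ℝ} (hf : MemLp f 2 volume) (x : T3) :
    (tconv ρ f x) ^ 2 ≤ ∫ y, ρ y * (f (x - y)) ^ 2 := by
  rw [tconv_eq_integral_sub]
  exact h.sq_integral_mul_le (memLp_comp_sub_left hf x)

theorem integral_tconv_sq_le (h : IsMollifier ρ) {f : T3 → ℝ} (hf : MemLp f 2 volume) :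
    ∫ x, (tconv ρ f x) ^ 2 ≤ ∫ x, f x ^ 2 := by
  have hi := h.integrable_conv_integrand hf.integrable_sq
  calc ∫ x, (tconv ρ f x) ^ 2 ≤ ∫ x, ∫ y, ρ y * (f (x - y)) ^ 2 := by
        refine integral_mono ?_ hi.integral_prod_left fun x => h.tconv_sq_le hf x
        exact ((continuous_tconv h.continuous (hf.integrable one_le_two)).pow 2
          ).integrable_of_hasCompactSupport (.of_compactSpace _)
    _ = ∫ y, ∫ x, ρ y * (f (x - y)) ^ 2 := integral_integral_swap hi
    _ = ∫ y, ρ y * ∫ x, f x ^ 2 := by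
        congr 1; ext y
        rw [integral_const_mul, integral_sub_right_eq_self (fun x => f x ^ 2) y]
    _ = ∫ x, f x ^ 2 := by rw [integral_mul_const, h.integral_eq_one, one_mul]

/-- By Jensen and Fubini the mollification error is at most a `ρ`-average of translation defects, so
it tends to the defect at `0` once `ρ` concentrates there. -/
theorem integral_tconv_sub_sq_le (h : IsMollifier ρ) {f : T3 → ℝ} (hf : MemLp f 2 volume) :
    ∫ x, (tconv ρ f x - f x) ^ 2 ≤ ∫ y, ρ y * translationDefect f y := by
  have hi : Integrable (fun p : T3 × T3 => ρ p.2 * (f (p.1 - p.2) - f p.1) ^ 2)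
      (volume.prod volume) := by
    have h1 := h.integrable_conv_integrand hf.integrable_sq
    have h2 : Integrable (fun p : T3 × T3 => f p.1 ^ 2 * ρ p.2) (volume.prod volume) :=
      hf.integrable_sq.mul_prod h.integrable
    refine ((h1.add h2).const_mul 2).mono' ?_ (Eventually.of_forall fun p => ?_)
    · have m1 : AEStronglyMeasurable (fun p : T3 × T3 => f (p.1 - p.2)) (volume.prod volume) :=
        hf.aestronglyMeasurable.comp_quasiMeasurePreserving
          (quasiMeasurePreserving_sub_of_right_invariant volume volume)
      have m2 : AEStronglyMeasurable (fun p : T3 × T3 => f p.1) (volume.prod volume) :=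
        hf.aestronglyMeasurable.comp_fst
      exact (h.continuous.comp continuous_snd).aestronglyMeasurable.mul ((m1.sub m2).pow 2)
    · have := h.nonneg p.2
      rw [Real.norm_eq_abs, abs_of_nonneg (by positivity)]
      simp only [Pi.add_apply]
      nlinarith [mul_nonneg this (sq_nonneg (f (p.1 - p.2) + f p.1))]
  have hm : MemLp (fun x => tconv ρ f x - f x) 2 volume := by
    refine MemLp.sub ?_ hf
    obtain ⟨C, -, hC⟩ := exists_bound_torus
      (continuous_tconv h.continuous (hf.integrable one_le_two))
    exact MemLp.of_bound (continuous_tconv h.continuous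
      (hf.integrable one_le_two)).aestronglyMeasurable C (Eventually.of_forall fun x => hC x)
  calc ∫ x, (tconv ρ f x - f x) ^ 2 ≤ ∫ x, ∫ y, ρ y * (f (x - y) - f x) ^ 2 :=
        integral_mono hm.integrable_sq hi.integral_prod_left fun x => h.tconv_sub_sq_le hf x
    _ = ∫ y, ∫ x, ρ y * (f (x - y) - f x) ^ 2 := integral_integral_swap hi
    _ = ∫ y, ρ y * translationDefect f y := by
        simp only [integral_const_mul, translationDefect]

end IsMollifier

/-! ### An explicit approximate identity made of trigonometric polynomials. -/

/-- The function whose powers, once normalized, form an approximate identity. -/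
def peak (x : T3) : ℝ := ∏ k : Fin 3, ((1 + (fourier 1 (x k) : ℂ).re) / 2)

theorem peak_torusMk (y : Fin 3 → ℝ) :
    peak (torusMk y) = ∏ k : Fin 3, ((1 + Real.cos (2 * Real.pi * y k)) / 2) := by
  refine Finset.prod_congr rfl fun k _ => ?_
  rw [torusMk, fourier_coe_apply]
  have : (2 * Real.pi * Complex.I * (1 : ℤ) * (y k : ℂ) / (1 : ℝ) : ℂ)
      = ((2 * Real.pi * y k : ℝ) : ℂ) * Complex.I := by push_cast; ring
  rw [this, Complex.exp_ofReal_mul_I_re]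

theorem continuous_peak : Continuous peak := by
  unfold peak
  fun_prop

theorem peak_factor_mem (x : UnitAddCircle) :
    (1 + (fourier 1 x : ℂ).re) / 2 ∈ Icc (0 : ℝ) 1 := by
  have h := Complex.abs_re_le_norm (fourier 1 x : ℂ)
  rw [fourier_apply, Circle.norm_coe] at h
  rw [fourier_apply]
  constructor <;> linarith [abs_le.1 h]

theorem peak_nonneg (x : T3) : 0 ≤ peak x :=
  Finset.prod_nonneg fun k _ => (peak_factor_mem (x k)).1

theorem peak_zero : peak 0 = 1 := by
  simp [peak]

/-- A factor equal to one forces a character value of modulus one and real part one, hence the value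
`1`, and the basic character of the circle is injective. -/
theorem peak_lt {x : T3} (hx : x ≠ 0) : peak x < peak 0 := by
  rw [peak_zero]
  obtain ⟨k, hk⟩ := Function.ne_iff.1 hx
  have h1 : (1 + (fourier 1 (x k) : ℂ).re) / 2 < 1 := by
    refine lt_of_le_of_ne (peak_factor_mem _).2 fun he => hk ?_
    have hre : (fourier 1 (x k) : ℂ).re = 1 := by linarith
    have hn : ‖(fourier 1 (x k) : ℂ)‖ = 1 := by rw [fourier_apply, Circle.norm_coe]
    have hone : (fourier 1 (x k) : ℂ) = 1 := by
      apply Complex.ext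
      · simpa using hre
      · have := Complex.sq_norm_sub_sq_re (fourier 1 (x k) : ℂ)
        rw [hn, hre] at this
        simpa using this.symm
    rw [fourier_apply, one_smul] at hone
    apply AddCircle.injective_toCircle one_ne_zero
    rw [Pi.zero_apply, AddCircle.toCircle_zero]
    exact Circle.ext hone
  calc peak x = ((1 + (fourier 1 (x k) : ℂ).re) / 2)
        * ∏ j ∈ Finset.univ.erase k, ((1 + (fourier 1 (x j) : ℂ).re) / 2) :=
        (Finset.mul_prod_erase _ _ (Finset.mem_univ k)).symm
    _ ≤ ((1 + (fourier 1 (x k) : ℂ).re) / 2) * 1 :=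
        mul_le_mul_of_nonneg_left (Finset.prod_le_one (fun j _ => (peak_factor_mem _).1)
          fun j _ => (peak_factor_mem _).2) (peak_factor_mem _).1
    _ < 1 := by rwa [mul_one]

/-- The normalized powers of `peak`. -/
def moll (N : ℕ) (x : T3) : ℝ := (∫ y, peak y ^ N)⁻¹ * peak x ^ N

theorem integral_peak_pow_pos (N : ℕ) : 0 < ∫ y, peak y ^ N := by
  refine Continuous.integral_pos_of_hasCompactSupport_nonneg_nonzero (x := 0)
    (continuous_peak.pow N) (.of_compactSpace _) (fun x => pow_nonneg (peak_nonneg x) N) ?_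
  simp [peak_zero]

theorem isMollifier_moll (N : ℕ) : IsMollifier (moll N) where
  smooth := by
    simp only [moll, peak_torusMk]
    fun_prop
  nonneg x := mul_nonneg (inv_nonneg.2 (integral_peak_pow_pos N).le)
    (pow_nonneg (peak_nonneg x) N)
  integral_eq_one := by
    simp only [moll]
    rw [integral_const_mul, inv_mul_cancel₀ (integral_peak_pow_pos N).ne']

/-- Normalized powers of a nonnegative continuous function concentrate at its unique maximum point.
-/
theorem tendsto_integral_moll_mul {g : T3 → ℝ} (hg : Continuous g) :
    Tendsto (fun N => ∫ y, moll N y * g y) atTop (𝓝 (g 0)) := by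
  have := tendsto_setIntegral_pow_smul_of_unique_maximum_of_isCompact_of_continuousOn
    (μ := (volume : Measure T3)) (x₀ := (0 : T3)) (s := univ) (c := peak) (g := g) isCompact_univ
    continuous_peak.continuousOn (fun y _ => peak_lt) (fun y _ => peak_nonneg y)
    (by simp [peak_zero]) (by simp) hg.continuousOn
  simpa [moll, mul_assoc, integral_const_mul] using this

theorem tendsto_integral_tconv_sub_sq {f : T3 → ℝ} (hf : MemLp f 2 volume) :
    Tendsto (fun N => ∫ x, (tconv (moll N) f x - f x) ^ 2) atTop (𝓝 0) := by
  have h := tendsto_integral_moll_mul (continuous_translationDefect hf)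
  rw [translationDefect_zero] at h
  exact squeeze_zero (fun N => integral_nonneg fun x => sq_nonneg _)
    (fun N => (isMollifier_moll N).integral_tconv_sub_sq_le hf) h

/-! ### Convergence in `L²` -/

section TendstoL2

variable {α : Type*} [MeasurableSpace α] {μ : Measure α}

/-- The sequence `u` converges to `v` in `L²(μ)`. -/
structure TendstoL2 (μ : Measure α) (u : ℕ → α → ℝ) (v : α → ℝ) : Prop where
  memLp : ∀ N, MemLp (u N) 2 μ
  memLp_lim : MemLp v 2 μ
  tendsto : Tendsto (fun N => ∫ x, (u N x - v x) ^ 2 ∂μ) atTop (𝓝 0)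

namespace TendstoL2

variable {u u' : ℕ → α → ℝ} {v v' : α → ℝ}

theorem const (hv : MemLp v 2 μ) : TendstoL2 μ (fun _ => v) v :=
  ⟨fun _ => hv, hv, by simp⟩

theorem comp (h : TendstoL2 μ u v) {ns : ℕ → ℕ} (hns : Tendsto ns atTop atTop) :
    TendstoL2 μ (fun N => u (ns N)) v :=
  ⟨fun N => h.memLp (ns N), h.memLp_lim, h.tendsto.comp hns⟩

theorem of_tendsto_toLp (hu : ∀ N, MemLp (u N) 2 μ) (hv : MemLp v 2 μ)
    (h : Tendsto (fun N => (hu N).toLp (u N)) atTop (𝓝 (hv.toLp v))) : TendstoL2 μ u v := by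
  refine ⟨hu, hv, ?_⟩
  have h1 := (tendsto_iff_norm_sub_tendsto_zero.1 h).pow 2
  rw [zero_pow two_ne_zero] at h1
  refine h1.congr fun N => ?_
  rw [← MemLp.toLp_sub, ← integral_sq_eq_norm_sq]
  rfl

theorem tendsto_toLp (h : TendstoL2 μ u v) :
    Tendsto (fun N => (h.memLp N).toLp (u N)) atTop (𝓝 (h.memLp_lim.toLp v)) := by
  rw [tendsto_iff_norm_sub_tendsto_zero]
  have h1 := h.tendsto.sqrt
  rw [Real.sqrt_zero] at h1
  refine h1.congr fun N => ?_
  rw [← MemLp.toLp_sub]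
  rw [show (∫ x, (u N x - v x) ^ 2 ∂μ) = ∫ x, (u N - v) x ^ 2 ∂μ from rfl,
    integral_sq_eq_norm_sq ((h.memLp N).sub h.memLp_lim), Real.sqrt_sq (norm_nonneg _)]

theorem tendsto_integral_mul (h : TendstoL2 μ u v) (h' : TendstoL2 μ u' v') :
    Tendsto (fun N => ∫ x, u N x * u' N x ∂μ) atTop (𝓝 (∫ x, v x * v' x ∂μ)) := by
  have key : ∀ {f g : α → ℝ} (hf : MemLp f 2 μ) (hg : MemLp g 2 μ),
      ∫ x, f x * g x ∂μ = inner ℝ (hf.toLp f) (hg.toLp g) := by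
    intro f g hf hg
    rw [L2.inner_def]
    refine integral_congr_ae ?_
    filter_upwards [hf.coeFn_toLp, hg.coeFn_toLp] with x hx hy
    rw [hx, hy]
    simp [mul_comm]
  rw [key h.memLp_lim h'.memLp_lim]
  simp only [fun N => key (h.memLp N) (h'.memLp N)]
  exact h.tendsto_toLp.inner h'.tendsto_toLp

theorem add (h : TendstoL2 μ u v) (h' : TendstoL2 μ u' v') :
    TendstoL2 μ (fun N x => u N x + u' N x) (fun x => v x + v' x) :=
  of_tendsto_toLp (fun N => (h.memLp N).add (h'.memLp N)) (h.memLp_lim.add h'.memLp_lim)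
    (h.tendsto_toLp.add h'.tendsto_toLp)

theorem exists_subseq (h : TendstoL2 μ u v) : ∃ ns : ℕ → ℕ, StrictMono ns ∧
    ∀ᵐ x ∂μ, Tendsto (fun N => u (ns N) x) atTop (𝓝 (v x)) := by
  have h1 : Tendsto (fun N => eLpNorm (u N - v) 2 μ) atTop (𝓝 0) :=
    (Lp.tendsto_Lp_iff_tendsto_eLpNorm'' _ h.memLp v h.memLp_lim).1 h.tendsto_toLp
  exact (tendstoInMeasure_of_tendsto_eLpNorm two_ne_zero
    (fun N => (h.memLp N).aestronglyMeasurable) h.memLp_lim.aestronglyMeasurable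
    h1).exists_seq_tendsto_ae

end TendstoL2

/-! ### Continuous functions of `[0,1]`-valued sequences as multipliers on `L²`. -/

theorem exists_bound_Icc {F : ℝ × ℝ → ℝ} (hF : Continuous F) :
    ∃ C, 0 ≤ C ∧ ∀ a ∈ Icc (0 : ℝ) 1, ∀ b ∈ Icc (0 : ℝ) 1, |F (a, b)| ≤ C := by
  obtain ⟨C, hC⟩ := ((isCompact_Icc (a := (0 : ℝ)) (b := 1)).prod
    (isCompact_Icc (a := (0 : ℝ)) (b := 1))).exists_bound_of_continuousOn hF.continuousOn
  exact ⟨C, (norm_nonneg _).trans (hC (0, 0) (by simp)), fun a ha b hb => hC (a, b) ⟨ha, hb⟩⟩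

theorem memLp_comp_mul {F : ℝ × ℝ → ℝ} (hF : Continuous F) {a b u : α → ℝ}
    (ha : AEStronglyMeasurable a μ) (hb : AEStronglyMeasurable b μ)
    (ha01 : ∀ᵐ x ∂μ, a x ∈ Icc (0 : ℝ) 1) (hb01 : ∀ᵐ x ∂μ, b x ∈ Icc (0 : ℝ) 1)
    (hu : MemLp u 2 μ) : MemLp (fun x => F (a x, b x) * u x) 2 μ := by
  obtain ⟨C, hC0, hC⟩ := exists_bound_Icc hF
  refine MemLp.of_le_mul (c := C) hu
    ((hF.comp_aestronglyMeasurable (ha.prodMk hb)).mul hu.aestronglyMeasurable) ?_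
  filter_upwards [ha01, hb01] with x h1 h2
  rw [norm_mul]
  exact mul_le_mul_of_nonneg_right (hC _ h1 _ h2) (norm_nonneg _)

theorem TendstoL2.mem_Icc {u : ℕ → α → ℝ} {v : α → ℝ} (h : TendstoL2 μ u v)
    (hu : ∀ N, ∀ᵐ x ∂μ, u N x ∈ Icc (0 : ℝ) 1) : ∀ᵐ x ∂μ, v x ∈ Icc (0 : ℝ) 1 := by
  obtain ⟨ns, -, hns⟩ := h.exists_subseq
  filter_upwards [hns, ae_all_iff.2 hu] with x h1 h2
  exact isClosed_Icc.mem_of_tendsto h1 (Eventually.of_forall fun N => h2 (ns N))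

/-- Multiplication by a continuous function of bounded `L²`-convergent sequences preserves
convergence in `L²`. -/
theorem TendstoL2.comp_mul {F : ℝ × ℝ → ℝ} (hF : Continuous F) {a b u : ℕ → α → ℝ}
    {a₀ b₀ v : α → ℝ} (ha : TendstoL2 μ a a₀) (hb : TendstoL2 μ b b₀) (hu : TendstoL2 μ u v)
    (ha01 : ∀ N, ∀ᵐ x ∂μ, a N x ∈ Icc (0 : ℝ) 1) (hb01 : ∀ N, ∀ᵐ x ∂μ, b N x ∈ Icc (0 : ℝ) 1) :
    TendstoL2 μ (fun N x => F (a N x, b N x) * u N x) (fun x => F (a₀ x, b₀ x) * v x) := by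
  obtain ⟨C, hC0, hC⟩ := exists_bound_Icc hF
  have ha' := ha.mem_Icc ha01
  have hb' := hb.mem_Icc hb01
  have hm : ∀ N {w : α → ℝ}, MemLp w 2 μ → MemLp (fun x => F (a N x, b N x) * w x) 2 μ :=
    fun N w hw => memLp_comp_mul hF (ha.memLp N).aestronglyMeasurable
      (hb.memLp N).aestronglyMeasurable (ha01 N) (hb01 N) hw
  have hm₀ : MemLp (fun x => F (a₀ x, b₀ x) * v x) 2 μ :=
    memLp_comp_mul hF ha.memLp_lim.aestronglyMeasurable hb.memLp_lim.aestronglyMeasurable ha' hb'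
      hu.memLp_lim
  -- Continuity of `F` needs almost everywhere convergence of `a` and `b`, available only along
  -- subsequences; it suffices to find a good one inside every subsequence.
  refine ⟨fun N => hm N (hu.memLp N), hm₀, tendsto_of_subseq_tendsto fun ns hns => ?_⟩
  obtain ⟨ms, hms, hma⟩ := (ha.comp hns).exists_subseq
  obtain ⟨ks, hks, hkb⟩ := ((hb.comp hns).comp hms.tendsto_atTop).exists_subseq
  refine ⟨fun j => ms (ks j), ?_⟩
  have hn : Tendsto (fun j => ns (ms (ks j))) atTop atTop :=
    hns.comp (hms.tendsto_atTop.comp hks.tendsto_atTop)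
  set n : ℕ → ℕ := fun j => ns (ms (ks j)) with hndef
  have hsq : ∀ j, Integrable (fun x => (F (a (n j) x, b (n j) x) * v x - F (a₀ x, b₀ x) * v x) ^ 2)
      μ := fun j => ((hm (n j) hu.memLp_lim).sub hm₀).integrable_sq
  -- With `v` frozen, dominated convergence applies: the coefficients are bounded by `C`, so `(2C)²
  -- v²` dominates.
  have hlim : Tendsto (fun j => ∫ x, (F (a (n j) x, b (n j) x) * v x
      - F (a₀ x, b₀ x) * v x) ^ 2 ∂μ) atTop (𝓝 0) := by
    have := tendsto_integral_of_dominated_convergence (μ := μ)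
      (F := fun j x => (F (a (n j) x, b (n j) x) * v x - F (a₀ x, b₀ x) * v x) ^ 2)
      (f := fun _ => 0) (fun x => (2 * C) ^ 2 * v x ^ 2) (fun j => (hsq j).aestronglyMeasurable)
      (hu.memLp_lim.integrable_sq.const_mul _) (fun j => ?_) ?_
    · simpa using this
    · filter_upwards [ha01 (n j), hb01 (n j), ha', hb'] with x h1 h2 h3 h4
      rw [← sub_mul, mul_pow, norm_mul, Real.norm_of_nonneg (sq_nonneg _),
        Real.norm_of_nonneg (sq_nonneg (v x))]
      refine mul_le_mul_of_nonneg_right ?_ (sq_nonneg _)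
      refine sq_le_sq' ?_ ?_ <;> linarith [abs_le.1 (hC _ h1 _ h2), abs_le.1 (hC _ h3 _ h4)]
    · filter_upwards [hma, hkb] with x h1 h2
      have h3 : Tendsto (fun j => F (a (n j) x, b (n j) x)) atTop (𝓝 (F (a₀ x, b₀ x))) :=
        (hF.tendsto (a₀ x, b₀ x)).comp ((h1.comp hks.tendsto_atTop).prodMk_nhds h2)
      have h4 := ((h3.mul_const (v x)).sub_const (F (a₀ x, b₀ x) * v x)).pow 2
      simpa using h4
  -- Split `F_N u_N - F v = F_N (u_N - v) + (F_N v - F v)` and use `(x + y)² ≤ 2x² + 2y²`.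
  have hbound := ((hu.tendsto.comp hn).const_mul (2 * C ^ 2)).add (hlim.const_mul 2)
  rw [mul_zero, mul_zero, add_zero] at hbound
  refine squeeze_zero (fun j => integral_nonneg fun x => sq_nonneg _) (fun j => ?_) hbound
  have hi1 : Integrable (fun x => (u (n j) x - v x) ^ 2) μ :=
    ((hu.memLp (n j)).sub hu.memLp_lim).integrable_sq
  change ∫ x, (F (a (n j) x, b (n j) x) * u (n j) x - F (a₀ x, b₀ x) * v x) ^ 2 ∂μ
    ≤ 2 * C ^ 2 * (∫ x, (u (n j) x - v x) ^ 2 ∂μ) + _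
  rw [← integral_const_mul, ← integral_const_mul,
    ← integral_add (hi1.const_mul _) ((hsq j).const_mul _)]
  refine integral_mono_ae ((hm (n j) (hu.memLp (n j))).sub hm₀).integrable_sq
    ((hi1.const_mul _).add ((hsq j).const_mul _)) ?_
  filter_upwards [ha01 (n j), hb01 (n j)] with x h1 h2
  have h3 : F (a (n j) x, b (n j) x) ^ 2 ≤ C ^ 2 := sq_le_sq' (abs_le.1 (hC _ h1 _ h2)).1
    (abs_le.1 (hC _ h1 _ h2)).2
  change (F (a (n j) x, b (n j) x) * u (n j) x - F (a₀ x, b₀ x) * v x) ^ 2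
    ≤ 2 * C ^ 2 * (u (n j) x - v x) ^ 2
      + 2 * (F (a (n j) x, b (n j) x) * v x - F (a₀ x, b₀ x) * v x) ^ 2
  have h4 := mul_le_mul_of_nonneg_right h3 (sq_nonneg (u (n j) x - v x))
  nlinarith [sq_nonneg (F (a (n j) x, b (n j) x) * (u (n j) x - v x)
    - (F (a (n j) x, b (n j) x) * v x - F (a₀ x, b₀ x) * v x))]

end TendstoL2

/-! ### Mollification in space of functions on space-time -/

/-- The mollification of `f` in the space variable. -/
def stconv (ρ : T3 → ℝ) (f : ℝ × T3 → ℝ) (p : ℝ × T3) : ℝ := tconv ρ (fun y => f (p.1, y)) p.2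

theorem stronglyMeasurable_stconv {ρ : T3 → ℝ} (hρ : Continuous ρ) {f : ℝ × T3 → ℝ}
    (hf : StronglyMeasurable f) : StronglyMeasurable (stconv ρ f) := by
  have h1 : StronglyMeasurable fun q : (ℝ × T3) × T3 => ρ (q.1.2 - q.2) * f (q.1.1, q.2) :=
    (hρ.comp (by fun_prop : Continuous fun q : (ℝ × T3) × T3 =>
      q.1.2 - q.2)).stronglyMeasurable.mul (hf.comp_measurable (by fun_prop))
  exact h1.integral_prod_right

section SpaceTime

variable {μ : Measure ℝ} [SFinite μ] {ρ : T3 → ℝ} {f : ℝ × T3 → ℝ}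

theorem ae_memLp_slice (hf : StronglyMeasurable f) (hf2 : MemLp f 2 (μ.prod volume)) :
    ∀ᵐ t ∂μ, MemLp (fun x => f (t, x)) 2 volume := by
  filter_upwards [hf2.integrable_sq.prod_right_ae] with t ht
  exact (memLp_two_iff_integrable_sq
    (hf.comp_measurable measurable_prodMk_left).aestronglyMeasurable).2 ht

theorem memLp_tconv (h : IsMollifier ρ) {g : T3 → ℝ} (hg : MemLp g 2 volume) :
    MemLp (tconv ρ g) 2 volume := by
  have hc := continuous_tconv h.continuous (hg.integrable one_le_two)
  obtain ⟨C, -, hC⟩ := exists_bound_torus hc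
  exact MemLp.of_bound hc.aestronglyMeasurable C (Eventually.of_forall fun x => hC x)

theorem memLp_stconv (h : IsMollifier ρ) (hf : StronglyMeasurable f)
    (hf2 : MemLp f 2 (μ.prod volume)) : MemLp (stconv ρ f) 2 (μ.prod volume) := by
  have hm := stronglyMeasurable_stconv h.continuous hf
  have hm2 : StronglyMeasurable fun p => stconv ρ f p ^ 2 := hm.pow 2
  rw [memLp_two_iff_integrable_sq hm.aestronglyMeasurable,
    integrable_prod_iff hm2.aestronglyMeasurable]
  constructor
  · filter_upwards [ae_memLp_slice hf hf2] with t ht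
    exact (memLp_tconv h ht).integrable_sq
  · refine hf2.integrable_sq.integral_prod_left.mono'
      hm2.norm.integral_prod_right.aestronglyMeasurable ?_
    filter_upwards [ae_memLp_slice hf hf2] with t ht
    rw [Real.norm_of_nonneg (integral_nonneg fun x => norm_nonneg _)]
    simp only [Real.norm_eq_abs, abs_sq]
    exact h.integral_tconv_sq_le ht

theorem tendstoL2_tconv {g : T3 → ℝ} (hg : MemLp g 2 volume) :
    TendstoL2 volume (fun N => tconv (moll N) g) g :=
  ⟨fun N => memLp_tconv (isMollifier_moll N) hg, hg, tendsto_integral_tconv_sub_sq hg⟩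

/-- Convergence on almost every time slice is the result on the torus; the `L²` contraction property
of mollification supplies the majorant `4 ∫ f(t, ·)²`, integrable in time. -/
theorem tendstoL2_stconv (hf : StronglyMeasurable f) (hf2 : MemLp f 2 (μ.prod volume)) :
    TendstoL2 (μ.prod volume) (fun N => stconv (moll N) f) f := by
  have hst := fun N => memLp_stconv (isMollifier_moll N) hf hf2
  refine ⟨hst, hf2, ?_⟩
  have hi := fun N => ((hst N).sub hf2).integrable_sq
  have e := fun N => integral_prod _ (hi N)
  simp only [Pi.sub_apply] at e
  simp only [e]
  have := tendsto_integral_of_dominated_convergence (μ := μ)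
    (F := fun N t => ∫ x, (stconv (moll N) f (t, x) - f (t, x)) ^ 2)
    (f := fun _ => 0) (fun t => 4 * ∫ x, f (t, x) ^ 2)
    (fun N => (hi N).integral_prod_left.aestronglyMeasurable)
    (hf2.integrable_sq.integral_prod_left.const_mul 4) (fun N => ?_) ?_
  · simpa using this
  · filter_upwards [ae_memLp_slice hf hf2] with t ht
    have h1 := memLp_tconv (isMollifier_moll N) ht
    have h2 := (isMollifier_moll N).integral_tconv_sq_le ht
    rw [Real.norm_of_nonneg (integral_nonneg fun x => sq_nonneg _)]
    have h3 := h1.integrable_sq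
    have h4 := ht.integrable_sq
    have h5 := integral_mono (h1.sub ht).integrable_sq ((h3.const_mul 2).add (h4.const_mul 2))
      fun x => by
        simp only [Pi.sub_apply, Pi.add_apply]
        nlinarith [sq_nonneg (tconv (moll N) (fun y => f (t, y)) x + f (t, x))]
    have h6 := integral_add (h3.const_mul 2) (h4.const_mul 2)
    rw [integral_const_mul, integral_const_mul] at h6
    have h7 := h5.trans_eq h6
    change ∫ x, (tconv (moll N) (fun y => f (t, y)) x - f (t, x)) ^ 2 ≤ _ at h7
    change ∫ x, (tconv (moll N) (fun y => f (t, y)) x - f (t, x)) ^ 2 ≤ _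
    linarith
  · filter_upwards [ae_memLp_slice hf hf2] with t ht
    have h := tendsto_integral_tconv_sub_sq ht
    exact h

end SpaceTime

/-! ### Absolutely continuous functions of one variable -/

/-- Absolutely continuous functions are bounded, so the pair stays in a compact convex box, on which
a `C¹` function is Lipschitz. -/
theorem HasPartials.comp_absolutelyContinuous {F F₁ F₂ : ℝ × ℝ → ℝ} (hF : HasPartials F F₁ F₂)
    {f g : ℝ → ℝ} {a b : ℝ} (hf : AbsolutelyContinuousOnInterval f a b)
    (hg : AbsolutelyContinuousOnInterval g a b) :
    AbsolutelyContinuousOnInterval (fun t => F (f t, g t)) a b := by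
  obtain ⟨Cf, hCf⟩ := hf.exists_bound
  obtain ⟨Cg, hCg⟩ := hg.exists_bound
  set K : Set (ℝ × ℝ) := Metric.closedBall (0 : ℝ) Cf ×ˢ Metric.closedBall (0 : ℝ) Cg
  have hK : IsCompact K := (isCompact_closedBall _ _).prod (isCompact_closedBall _ _)
  obtain ⟨C₁, hC₁⟩ := hK.exists_bound_of_continuousOn hF.continuous_fst.continuousOn
  obtain ⟨C₂, hC₂⟩ := hK.exists_bound_of_continuousOn hF.continuous_snd.continuousOn
  have hmem : ∀ t ∈ uIcc a b, (f t, g t) ∈ K := fun t ht => by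
    simpa [K] using ⟨hCf t ht, hCg t ht⟩
  have hC₁0 : ∀ t ∈ uIcc a b, 0 ≤ C₁ := fun t ht => (norm_nonneg _).trans (hC₁ _ (hmem t ht))
  have hC₂0 : ∀ t ∈ uIcc a b, 0 ≤ C₂ := fun t ht => (norm_nonneg _).trans (hC₂ _ (hmem t ht))
  have hlip : ∀ z ∈ K, ∀ w ∈ K, ‖F w - F z‖ ≤ (C₁ + C₂) * ‖w - z‖ := by
    intro z hz w hw
    refine Convex.norm_image_sub_le_of_norm_hasFDerivWithin_le
      (fun p _ => (hF.hasFDerivAt p).hasFDerivWithinAt) (fun p hp => ?_)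
      ((convex_closedBall _ _).prod (convex_closedBall _ _)) hz hw
    refine (norm_add_le _ _).trans (add_le_add ?_ ?_)
    · rw [norm_smul]
      exact (mul_le_of_le_one_right (norm_nonneg _)
        (ContinuousLinearMap.norm_fst_le ℝ ℝ ℝ)).trans (hC₁ p hp)
    · rw [norm_smul]
      exact (mul_le_of_le_one_right (norm_nonneg _)
        (ContinuousLinearMap.norm_snd_le ℝ ℝ ℝ)).trans (hC₂ p hp)
  have hsum : Tendsto (fun E : ℕ × (ℕ → ℝ × ℝ) =>
      (C₁ + C₂) * ((∑ i ∈ Finset.range E.1, dist (f (E.2 i).1) (f (E.2 i).2))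
        + ∑ i ∈ Finset.range E.1, dist (g (E.2 i).1) (g (E.2 i).2)))
      (AbsolutelyContinuousOnInterval.totalLengthFilter ⊓
        𝓟 (AbsolutelyContinuousOnInterval.disjWithin a b)) (𝓝 0) := by
    have := (Tendsto.add hf hg).const_mul (C₁ + C₂)
    simpa using this
  refine squeeze_zero' (Eventually.of_forall fun E => Finset.sum_nonneg fun i _ => dist_nonneg)
    ?_ hsum
  filter_upwards [mem_inf_of_right (mem_principal_self _)] with E hE
  rw [← Finset.sum_add_distrib, Finset.mul_sum]
  refine Finset.sum_le_sum fun i hi => ?_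
  have h1 := hE.1 i hi
  rw [dist_comm, dist_eq_norm]
  refine (hlip _ (hmem _ h1.1) _ (hmem _ h1.2)).trans (mul_le_mul_of_nonneg_left ?_
    (add_nonneg (hC₁0 _ h1.1) (hC₂0 _ h1.1)))
  rw [← dist_eq_norm, Prod.dist_eq, dist_comm, dist_comm (g _)]
  exact max_le_add_of_nonneg dist_nonneg dist_nonneg

theorem absolutelyContinuous_const_add_integral {j : ℝ → ℝ} {T : ℝ}
    (hj : IntervalIntegrable j volume 0 T) (a : ℝ) :
    AbsolutelyContinuousOnInterval (fun t => a + ∫ s in (0 : ℝ)..t, j s) 0 T :=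
  (LipschitzOnWith.absolutelyContinuousOnInterval (K := 0) (by
    intro x _ y _; simp)).add (hj.absolutelyContinuousOnInterval_intervalIntegral (by simp))

/-- The chain rule for indefinite integrals. -/
theorem HasPartials.integral_chain {F F₁ F₂ : ℝ × ℝ → ℝ} (hF : HasPartials F F₁ F₂)
    {j l : ℝ → ℝ} {T : ℝ} (hj : IntervalIntegrable j volume 0 T)
    (hl : IntervalIntegrable l volume 0 T) (a b : ℝ) {f g : ℝ → ℝ}
    (hf : ∀ t, f t = a + ∫ s in (0 : ℝ)..t, j s) (hg : ∀ t, g t = b + ∫ s in (0 : ℝ)..t, l s) :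
    F (f T, g T) - F (a, b)
      = ∫ t in (0 : ℝ)..T, (F₁ (f t, g t) * j t + F₂ (f t, g t) * l t) := by
  have hfac := absolutelyContinuous_const_add_integral hj a
  have hgac := absolutelyContinuous_const_add_integral hl b
  rw [← funext hf] at hfac
  rw [← funext hg] at hgac
  have h := (hF.comp_absolutelyContinuous hfac hgac).integral_deriv_eq_sub
  have h0 : F (f 0, g 0) = F (a, b) := by simp [hf, hg]
  rw [← h0, ← h]
  apply intervalIntegral.integral_congr_ae
  filter_upwards [hj.ae_hasDerivAt_integral, hl.ae_hasDerivAt_integral] with t h1 h2 ht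
  have ht' := uIoc_subset_uIcc ht
  have e1 : HasDerivAt f (j t) t := by
    rw [funext hf]; exact (h1 ht' 0 (by simp)).const_add a
  have e2 : HasDerivAt g (l t) t := by
    rw [funext hg]; exact (h2 ht' 0 (by simp)).const_add b
  exact (hF.hasDerivAt_comp e1 e2).deriv

theorem intervalIntegrable_of_Ioo {j : ℝ → ℝ} {T : ℝ} (hT : 0 ≤ T)
    (hj : IntegrableOn j (Ioo 0 T)) : IntervalIntegrable j volume 0 T :=
  (intervalIntegrable_iff_integrableOn_Ioo_of_le hT).2 hj

theorem continuousOn_integral_of_Ioo {j : ℝ → ℝ} (hj : ∀ T > 0, IntegrableOn j (Ioo 0 T)) :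
    ContinuousOn (fun t => ∫ s in (0 : ℝ)..t, j s) (Ici 0) := by
  intro t ht
  have h0 : (0 : ℝ) ≤ t + 1 := by linarith [mem_Ici.1 ht]
  have h := intervalIntegral.continuousOn_primitive_interval (μ := volume) (a := 0) (b := t + 1)
    (f := j) (by
      rw [uIcc_of_le h0, integrableOn_Icc_iff_integrableOn_Ioo]
      exact hj _ (by linarith [mem_Ici.1 ht]))
  rw [uIcc_of_le h0] at h
  refine (h t ⟨ht, by linarith⟩).mono_of_mem_nhdsWithin ?_
  rw [← Ici_inter_Iic]
  exact inter_mem self_mem_nhdsWithin (mem_nhdsWithin_of_mem_nhds (Iic_mem_nhds (by linarith)))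

/-- A smooth compactly supported function with prescribed derivative on `(0, ∞)`. -/
theorem exists_primitive_test {ζ : ℝ → ℝ} (hζ : ContDiff ℝ ∞ ζ) (hc : HasCompactSupport ζ) :
    ∃ η : ℝ → ℝ, ContDiff ℝ ∞ η ∧ HasCompactSupport η ∧ ∀ t ∈ Ioi (0 : ℝ), deriv η t = ζ t := by
  obtain ⟨R, hR0, hR⟩ : ∃ R > 0, ∀ t, R < t → ζ t = 0 := by
    obtain ⟨R, hR⟩ := hc.isCompact.isBounded.subset_closedBall 0
    refine ⟨max R 1, by positivity, fun t ht => image_eq_zero_of_notMem_tsupport fun h => ?_⟩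
    have := hR h
    rw [Metric.mem_closedBall, dist_zero_right, Real.norm_eq_abs] at this
    have h2 := le_abs_self t
    have h3 := le_max_left R 1
    linarith
  -- Basing the primitive at `R` makes it vanish to the right of the support of `ζ`. To the left it
  -- may be a nonzero constant, which the cutoff `χ` removes without changing anything near `[0,
  -- R]`.
  set Z : ℝ → ℝ := fun t => ∫ s in R..t, ζ s with hZ
  have hZd : ∀ t, HasDerivAt Z (ζ t) t := fun t =>
    intervalIntegral.integral_hasDerivAt_right (hζ.continuous.intervalIntegrable _ _)
      (hζ.continuous.stronglyMeasurableAtFilter _ _) hζ.continuous.continuousAt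
  have hZs : ContDiff ℝ ∞ Z := contDiff_infty_iff_deriv.2
    ⟨fun t => (hZd t).differentiableAt, by rw [funext fun t => (hZd t).deriv]; exact hζ⟩
  have hZ0 : ∀ t, R < t → Z t = 0 := by
    intro t ht
    rw [hZ]
    simp only
    rw [intervalIntegral.integral_of_le ht.le]
    exact setIntegral_eq_zero_of_forall_eq_zero fun s hs => hR s hs.1
  let χ : ContDiffBump (0 : ℝ) := ⟨R + 1, R + 2, by linarith, by linarith⟩
  refine ⟨fun t => Z t * χ t, hZs.mul χ.contDiff, χ.hasCompactSupport.mul_left, fun t ht => ?_⟩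
  rcases lt_or_ge t (R + 1) with h | h
  · have he : (fun t => Z t * χ t) =ᶠ[𝓝 t] Z := by
      have : Metric.ball (0 : ℝ) (R + 1) ∈ 𝓝 t := by
        refine Metric.isOpen_ball.mem_nhds ?_
        rw [Metric.mem_ball, dist_zero_right, Real.norm_eq_abs, abs_of_pos ht]
        exact h
      filter_upwards [this] with s hs
      rw [χ.one_of_mem_closedBall (Metric.ball_subset_closedBall hs), mul_one]
    rw [he.deriv_eq, (hZd t).deriv]
  · have he : (fun t => Z t * χ t) =ᶠ[𝓝 t] fun _ => 0 := by
      filter_upwards [lt_mem_nhds (by linarith : R < t)] with s hs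
      rw [hZ0 s hs, zero_mul]
    rw [he.deriv_eq, hR t (by linarith)]
    simp

/-- A function on `(0, ∞)` whose weak derivative is `j` and whose weak initial value is `a` is
almost everywhere equal to the corresponding indefinite integral. -/
theorem ae_eq_of_weak_deriv {f j : ℝ → ℝ} {a : ℝ} (hf : ∀ T > 0, IntegrableOn f (Ioo 0 T))
    (hj : ∀ T > 0, IntegrableOn j (Ioo 0 T))
    (h : ∀ η : ℝ → ℝ, ContDiff ℝ ∞ η → HasCompactSupport η →
      a * η 0 + (∫ t in Ioi (0 : ℝ), deriv η t * f t) + ∫ t in Ioi (0 : ℝ), η t * j t = 0) :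
    ∀ᵐ t ∂(volume.restrict (Ioi (0 : ℝ))), f t = a + ∫ s in (0 : ℝ)..t, j s := by
  set w : ℝ → ℝ := fun t => a + ∫ s in (0 : ℝ)..t, j s with hw
  have hwc : ContinuousOn w (Ici 0) := continuousOn_const.add (continuousOn_integral_of_Ioo hj)
  have hwi : ∀ T > 0, IntegrableOn w (Ioo 0 T) := fun T _ =>
    ((hwc.mono Icc_subset_Ici_self).integrableOn_compact isCompact_Icc).mono_set
      Ioo_subset_Icc_self
  have hloc : LocallyIntegrableOn (fun t => f t - w t) (Ioi 0) := by
    intro t ht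
    refine ⟨Ioo 0 (t + 1), mem_nhdsWithin_of_mem_nhds (Ioo_mem_nhds ht (by linarith)), ?_⟩
    have h1 : (0 : ℝ) < t + 1 := by linarith [mem_Ioi.1 ht]
    exact (hf _ h1).sub (hwi _ h1)
  have key := isOpen_Ioi.ae_eq_zero_of_integral_contDiff_smul_eq_zero hloc (fun ζ hζ hc hs => ?_)
  · rw [ae_restrict_iff' measurableSet_Ioi]
    filter_upwards [key] with t ht h0
    linarith [ht h0]
  -- An arbitrary test function `ζ` is written as a derivative on the half-line; `η 0` is left free,
  -- so the initial value `a` enters.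
  obtain ⟨η, hη, hηc, hηd⟩ := exists_primitive_test hζ hc
  obtain ⟨T, hT0, hT⟩ : ∃ T > 0, ∀ t, T ≤ t → η t = 0 ∧ ζ t = 0 := by
    obtain ⟨R, hR⟩ := (hηc.isCompact.union hc.isCompact).isBounded.subset_closedBall 0
    refine ⟨max R 0 + 1, by positivity, fun t ht => ?_⟩
    have h1 : t ∉ tsupport η ∪ tsupport ζ := fun h => by
      have := hR h
      rw [Metric.mem_closedBall, dist_zero_right, Real.norm_eq_abs] at this
      have h2 := le_abs_self t
      have h3 := le_max_left R 0
      linarith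
    exact ⟨image_eq_zero_of_notMem_tsupport fun h => h1 (Or.inl h),
      image_eq_zero_of_notMem_tsupport fun h => h1 (Or.inr h)⟩
  have red : ∀ g : ℝ → ℝ, (∀ t, T ≤ t → g t = 0) →
      ∫ t in Ioi (0 : ℝ), g t = ∫ t in (0 : ℝ)..T, g t := by
    intro g hg
    rw [intervalIntegral.integral_of_le hT0.le, integral_Ioc_eq_integral_Ioo]
    refine setIntegral_eq_of_subset_of_forall_sdiff_eq_zero measurableSet_Ioi Ioo_subset_Ioi_self
      fun t ht => hg t ?_
    by_contra hlt
    exact ht.2 ⟨ht.1, not_le.1 hlt⟩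
  have hjI := intervalIntegrable_of_Ioo hT0.le (hj T hT0)
  have hwac : AbsolutelyContinuousOnInterval w 0 T := absolutelyContinuous_const_add_integral hjI a
  have hηac : AbsolutelyContinuousOnInterval η 0 T :=
    (hη.of_le (by norm_cast)).contDiffOn.absolutelyContinuousOnInterval
  -- Integration by parts gives `w` the same weak identity as `f`; in the difference the terms `a *
  -- η 0` and `∫ η j` cancel, leaving `∫ ζ (f - w) = 0`.
  have hparts := hηac.integral_mul_deriv_eq_deriv_mul hwac
  have hder : ∫ t in (0 : ℝ)..T, η t * deriv w t = ∫ t in (0 : ℝ)..T, η t * j t := by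
    apply intervalIntegral.integral_congr_ae
    filter_upwards [hjI.ae_hasDerivAt_integral] with t h1 ht
    rw [((h1 (uIoc_subset_uIcc ht) 0 (by simp)).const_add a).deriv]
  have hη' : ∀ g : ℝ → ℝ, ∫ t in Ioi (0 : ℝ), deriv η t * g t = ∫ t in (0 : ℝ)..T, ζ t * g t := by
    intro g
    rw [← red _ fun t ht => by rw [(hT t ht).2, zero_mul]]
    exact setIntegral_congr_fun measurableSet_Ioi fun t ht => by simp only [hηd t ht]
  have hη'' : ∫ t in (0 : ℝ)..T, deriv η t * w t = ∫ t in (0 : ℝ)..T, ζ t * w t := by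
    rw [intervalIntegral.integral_of_le hT0.le, intervalIntegral.integral_of_le hT0.le]
    exact setIntegral_congr_fun measurableSet_Ioc fun t ht => by simp only [hηd t ht.1]
  have heq := h η hη hηc
  rw [hη' f, red _ fun t ht => by rw [(hT t ht).1, zero_mul]] at heq
  rw [hder, hη'', (hT T le_rfl).1] at hparts
  have hw0 : w 0 = a := by simp [hw]
  rw [hw0] at hparts
  have hζI : ∀ g : ℝ → ℝ, IntegrableOn g (Ioo 0 T) →
      IntervalIntegrable (fun t => ζ t * g t) volume 0 T := fun g hg =>
    (intervalIntegrable_of_Ioo hT0.le hg).continuousOn_mul hζ.continuous.continuousOn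
  have hsupp : ∫ t, ζ t • (f t - w t) = ∫ t in Ioi (0 : ℝ), ζ t * (f t - w t) := by
    rw [setIntegral_eq_integral_of_forall_compl_eq_zero]
    · rfl
    · intro t ht
      rw [image_eq_zero_of_notMem_tsupport fun h => ht (hs h), zero_mul]
  rw [hsupp, red _ fun t ht => by rw [(hT t ht).2, zero_mul]]
  simp only [mul_sub]
  rw [intervalIntegral.integral_sub (hζI f (hf T hT0)) (hζI w (hwi T hT0))]
  linarith

/-! ### Integrals over the space-time cylinder -/

theorem volume_restrict_cyl :
    (volume : Measure (ℝ × T3)).restrict cyl = (volume.restrict (Ioi 0)).prod volume := by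
  rw [Measure.volume_eq_prod, ← Measure.prod_restrict, Measure.restrict_univ]

theorem volume_restrict_cylUpTo (T : ℝ) :
    (volume : Measure (ℝ × T3)).restrict (cylUpTo T)
      = (volume.restrict (Ioo 0 T)).prod volume := by
  rw [Measure.volume_eq_prod, ← Measure.prod_restrict, Measure.restrict_univ]

theorem measurableSet_cyl : MeasurableSet cyl := measurableSet_Ioi.prod MeasurableSet.univ

theorem cylUpTo_subset_cyl (T : ℝ) : cylUpTo T ⊆ cyl := prod_mono Ioo_subset_Ioi_self subset_rfl

/-- `f` is measurable, and square integrable on all bounded space-time cylinders. -/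
structure LocL2 (f : ℝ × T3 → ℝ) : Prop where
  meas : StronglyMeasurable f
  memLp : ∀ T > 0, MemLp f 2 ((volume.restrict (Ioo 0 T)).prod volume)

/-- `g` vanishes for times of modulus at least `T`. -/
def TimeSupp (T : ℝ) (g : ℝ × T3 → ℝ) : Prop := ∀ p, T ≤ |p.1| → g p = 0

theorem TimeSupp.exists_bound {T : ℝ} {g : ℝ × T3 → ℝ} (h : TimeSupp T g) (hg : Continuous g) :
    ∃ C, 0 ≤ C ∧ ∀ p, |g p| ≤ C := by
  obtain ⟨C, hC⟩ := ((isCompact_Icc (a := -T) (b := T)).prod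
    (isCompact_univ (X := T3))).exists_bound_of_continuousOn hg.continuousOn
  refine ⟨max C 0, le_max_right _ _, fun p => ?_⟩
  by_cases hp : T ≤ |p.1|
  · rw [h p hp, abs_zero]; exact le_max_right _ _
  · exact (hC p ⟨abs_le.1 (not_le.1 hp).le, trivial⟩).trans (le_max_left _ _)

theorem TimeSupp.integral_cyl_eq {T : ℝ} {g : ℝ × T3 → ℝ} (h : TimeSupp T g) :
    ∫ p in cyl, g p = ∫ p in cylUpTo T, g p := by
  refine setIntegral_eq_of_subset_of_forall_sdiff_eq_zero measurableSet_cyl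
    (cylUpTo_subset_cyl T) fun p hp => h p ?_
  by_contra hlt
  have h0 : 0 < p.1 := hp.1.1
  rw [abs_of_pos h0] at hlt
  exact hp.2 ⟨⟨h0, not_le.1 hlt⟩, trivial⟩

theorem TimeSupp.mul_left {T : ℝ} {g : ℝ × T3 → ℝ} (h : TimeSupp T g) (f : ℝ × T3 → ℝ) :
    TimeSupp T fun p => f p * g p := fun p hp => by simp [h p hp]

theorem TimeSupp.memLp {T : ℝ} {g : ℝ × T3 → ℝ} (h : TimeSupp T g) (hg : Continuous g) (S : ℝ) :
    MemLp g 2 ((volume.restrict (Ioo 0 S)).prod volume) := by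
  obtain ⟨C, -, hC⟩ := h.exists_bound hg
  exact MemLp.of_bound hg.aestronglyMeasurable C (Eventually.of_forall fun p => hC p)

theorem LocL2.integrableOn_mul {f g : ℝ × T3 → ℝ} (hf : LocL2 f) {T : ℝ} (hT : 0 < T)
    (h : TimeSupp T g) (hg : Continuous g) : IntegrableOn (fun p => f p * g p) cyl := by
  have h1 : IntegrableOn (fun p => f p * g p) (cylUpTo T) := by
    rw [IntegrableOn, volume_restrict_cylUpTo]
    exact (hf.memLp T hT).integrable_mul (h.memLp hg T)
  refine h1.of_forall_sdiff_eq_zero measurableSet_cyl fun p hp => h.mul_left f p ?_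
  by_contra hlt
  have h0 : 0 < p.1 := hp.1.1
  rw [abs_of_pos h0] at hlt
  exact hp.2 ⟨⟨h0, not_le.1 hlt⟩, trivial⟩

theorem exists_timeSupp_of_hasCompactSupport {η : ℝ → ℝ} (h : HasCompactSupport η) :
    ∃ T > 0, ∀ t, T ≤ |t| → η t = 0 ∧ deriv η t = 0 := by
  obtain ⟨R, hR⟩ := h.isCompact.isBounded.subset_closedBall 0
  refine ⟨max R 0 + 1, by positivity, fun t ht => ?_⟩
  have h1 : t ∉ tsupport η := fun h => by
    have := hR h
    rw [Metric.mem_closedBall, dist_zero_right, Real.norm_eq_abs] at this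
    have h3 := le_max_left R 0
    linarith
  exact ⟨image_eq_zero_of_notMem_tsupport h1,
    image_eq_zero_of_notMem_tsupport fun h => h1 (tsupport_deriv_subset h)⟩

theorem LocL2.integrable_prod_kernel {f : ℝ × T3 → ℝ} (hf : LocL2 f) {κ : T3 → ℝ}
    (hκ : Continuous κ) {T : ℝ} (hT : 0 < T) :
    Integrable (fun p : ℝ × T3 => κ p.2 * f p) ((volume.restrict (Ioo 0 T)).prod volume) := by
  obtain ⟨C, -, hC⟩ := exists_bound_torus hκ
  exact ((hf.memLp T hT).integrable one_le_two).bdd_mul (c := C)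
    (hκ.comp continuous_snd).aestronglyMeasurable (Eventually.of_forall fun p => hC _)

theorem LocL2.integrableOn_stconv {f : ℝ × T3 → ℝ} (hf : LocL2 f) {κ : T3 → ℝ}
    (hκ : Continuous κ) (x : T3) {T : ℝ} (hT : 0 < T) :
    IntegrableOn (fun t => stconv κ f (t, x)) (Ioo 0 T) :=
  (hf.integrable_prod_kernel (by fun_prop : Continuous fun y => κ (x - y)) hT).integral_prod_left

/-- Fubini's theorem for a product of a function on space-time, a function of time, and a
translated kernel. -/
theorem LocL2.integral_cyl_mul_kernel {f : ℝ × T3 → ℝ} (hf : LocL2 f) {κ : T3 → ℝ}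
    (hκ : Continuous κ) {η : ℝ → ℝ} (hη : Continuous η) {T : ℝ} (hT : 0 < T)
    (hηT : ∀ t, T ≤ |t| → η t = 0) (x : T3) :
    ∫ p in cyl, f p * (η p.1 * κ (x - p.2)) = ∫ t in Ioi (0 : ℝ), η t * stconv κ f (t, x) := by
  have hi := hf.integrableOn_mul hT (g := fun p => η p.1 * κ (x - p.2))
    (fun p hp => by simp only [hηT _ hp, zero_mul]) (by fun_prop)
  rw [IntegrableOn, volume_restrict_cyl] at hi
  rw [volume_restrict_cyl, integral_prod _ hi]
  refine integral_congr_ae (Eventually.of_forall fun t => ?_)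
  simp only [stconv, tconv]
  rw [← integral_const_mul]
  exact integral_congr_ae (Eventually.of_forall fun y => by ring)

/-! ### Test functions of product form -/

/-- The product of a function of time and a reflected and translated kernel. -/
def prodTest (η : ℝ → ℝ) (ρ : T3 → ℝ) (x : T3) (p : ℝ × T3) : ℝ := η p.1 * ρ (x - p.2)

section ProdTest

variable {η : ℝ → ℝ} {ρ : T3 → ℝ}

theorem isTestFunction_prodTest (hη : ContDiff ℝ ∞ η) (hc : HasCompactSupport η)
    (hρ : IsMollifier ρ) (x : T3) : IsTestFunction (prodTest η ρ x) where
  smooth := by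
    obtain ⟨z, rfl⟩ := isOpenQuotientMap_torusMk.surjective x
    have h1 : ContDiff ℝ ∞ fun p : ℝ × (Fin 3 → ℝ) => ρ (torusMk (z - p.2)) :=
      hρ.smooth.comp (contDiff_const.sub contDiff_snd)
    simp only [torusMk_sub] at h1
    exact (hη.comp contDiff_fst).mul h1
  compact_support := by
    refine HasCompactSupport.intro (hc.isCompact.prod isCompact_univ) fun p hp => ?_
    have : p.1 ∉ tsupport η := fun h => hp ⟨h, trivial⟩
    rw [prodTest, image_eq_zero_of_notMem_tsupport this, zero_mul]

theorem tsupport_prodTest_subset (hs : tsupport η ⊆ Ioi 0) (x : T3) :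
    tsupport (prodTest η ρ x) ⊆ cyl := by
  refine (closure_minimal (t := tsupport η ×ˢ univ) (fun p hp => ?_)
    ((isClosed_tsupport η).prod isClosed_univ)).trans (prod_mono hs subset_rfl)
  exact ⟨subset_tsupport η (left_ne_zero_of_mul hp), trivial⟩

theorem spaceGrad_prodTest (hρ : IsMollifier ρ) (x : T3) (p : ℝ × T3) (k : Fin 3) :
    spaceGrad (prodTest η ρ x) p k = -(η p.1 * torusGrad ρ (x - p.2) k) := by
  have h : HasTorusDeriv k (fun y => prodTest η ρ x (p.1, y))
      (fun y => -(η p.1 * torusGrad ρ (x - y) k)) := by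
    intro y
    have h1 : HasDerivAt (fun s : ℝ => ρ (x - y + Pi.single k (s : UnitAddCircle)))
        (torusGrad ρ (x - y) k) (-0) := by simpa using hρ.hasTorusDeriv k (x - y)
    have h2 := (h1.comp (0 : ℝ) (hasDerivAt_neg (0 : ℝ))).const_mul (η p.1)
    rw [mul_neg_one, mul_neg] at h2
    refine h2.congr_of_eventuallyEq (Eventually.of_forall fun s => ?_)
    have e : (Pi.single k ((-s : ℝ) : UnitAddCircle) : T3)
        = -Pi.single k (s : UnitAddCircle) := by
      rw [← Pi.single_neg]; simp
    simp only [prodTest, Function.comp_def, e]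
    congr 2
    abel
  exact h.torusGrad_eq p.2

theorem timeDeriv_prodTest (hη : ContDiff ℝ ∞ η) (x : T3) (p : ℝ × T3) :
    timeDeriv (prodTest η ρ x) p = deriv η p.1 * ρ (x - p.2) := by
  have h : HasDerivAt η (deriv η p.1) p.1 := (hη.differentiable (by simp) p.1).hasDerivAt
  exact (h.mul_const (ρ (x - p.2))).deriv

end ProdTest

/-! ### Weak solutions of a single transport equation -/

/-- `c`, with values in `[0,1]`, has the weak spatial gradient `h`, and solves
`∂ₜc + div J = 0` weakly with the initial value `c₀`. -/
structure IsWeakSolution (c₀ : T3 → ℝ) (c : ℝ × T3 → ℝ) (h J : Fin 3 → ℝ × T3 → ℝ) : Prop where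
  meas_init : StronglyMeasurable c₀
  init_mem : ∀ x, c₀ x ∈ Icc (0 : ℝ) 1
  meas : StronglyMeasurable c
  mem : ∀ p, c p ∈ Icc (0 : ℝ) 1
  locL2_grad : ∀ k, LocL2 (h k)
  locL2_flux : ∀ k, LocL2 (J k)
  grad : ∀ φ : ℝ × T3 → ℝ, IsTestFunction φ → tsupport φ ⊆ cyl → ∀ k : Fin 3,
    ∫ p in cyl, c p * spaceGrad φ p k = - ∫ p in cyl, h k p * φ p
  eqn : ∀ φ : ℝ × T3 → ℝ, IsTestFunction φ →
    (∫ x, c₀ x * φ (0, x)) + (∫ p in cyl, c p * timeDeriv φ p)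
      + ∑ k, ∫ p in cyl, J k p * spaceGrad φ p k = 0

namespace IsWeakSolution

variable {c₀ : T3 → ℝ} {c : ℝ × T3 → ℝ} {h J : Fin 3 → ℝ × T3 → ℝ} {ρ : T3 → ℝ}

theorem locL2 (H : IsWeakSolution c₀ c h J) : LocL2 c where
  meas := H.meas
  memLp T _ := MemLp.of_bound H.meas.aestronglyMeasurable 1 (Eventually.of_forall fun p => by
    rw [Real.norm_eq_abs, abs_of_nonneg (H.mem p).1]; exact (H.mem p).2)

theorem memLp_init (H : IsWeakSolution c₀ c h J) : MemLp c₀ 2 volume :=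
  MemLp.of_bound H.meas_init.aestronglyMeasurable 1 (Eventually.of_forall fun x => by
    rw [Real.norm_eq_abs, abs_of_nonneg (H.init_mem x).1]; exact (H.init_mem x).2)

theorem integrable_slice (H : IsWeakSolution c₀ c h J) (t : ℝ) :
    Integrable fun y => c (t, y) :=
  Integrable.of_bound (H.meas.comp_measurable measurable_prodMk_left).aestronglyMeasurable 1
    (Eventually.of_forall fun x => by
      rw [Real.norm_eq_abs, abs_of_nonneg (H.mem _).1]; exact (H.mem _).2)

theorem stconv_mem (H : IsWeakSolution c₀ c h J) (hρ : IsMollifier ρ) (p : ℝ × T3) :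
    stconv ρ c p ∈ Icc (0 : ℝ) 1 :=
  hρ.tconv_mem_Icc (H.integrable_slice p.1).aestronglyMeasurable (fun _ => H.mem _) p.2

/-- The gradient of the mollification is the mollification of the weak gradient. -/
theorem ae_stconv_grad (H : IsWeakSolution c₀ c h J) (hρ : IsMollifier ρ) (k : Fin 3) :
    ∀ᵐ p ∂((volume.restrict (Ioi (0 : ℝ))).prod (volume : Measure T3)),
      stconv (fun x => torusGrad ρ x k) c p = stconv ρ (h k) p := by
  have hρc := hρ.continuous
  have hρ'c := hρ.continuous_torusGrad k
  have m1 := stronglyMeasurable_stconv hρ'c H.meas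
  have m2 := stronglyMeasurable_stconv hρc (H.locL2_grad k).meas
  -- The equality is proved for every `x` and almost every time depending on `x`; joint
  -- measurability permits exchanging the two quantifiers.
  have hms : MeasurableSet {q : T3 × ℝ | stconv (fun x => torusGrad ρ x k) c (q.2, q.1)
      = stconv ρ (h k) (q.2, q.1)} :=
    measurableSet_eq_fun (m1.comp_measurable measurable_swap).measurable
      (m2.comp_measurable measurable_swap).measurable
  rw [Measure.ae_prod_iff_ae_ae (measurableSet_eq_fun m1.measurable m2.measurable)]
  refine (Measure.ae_ae_comm (p := fun x t => stconv (fun x => torusGrad ρ x k) c (t, x)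
      = stconv ρ (h k) (t, x)) hms).1 (Eventually.of_forall fun x => ?_)
  have hloc : LocallyIntegrableOn (fun t => stconv (fun x => torusGrad ρ x k) c (t, x)
      - stconv ρ (h k) (t, x)) (Ioi 0) := by
    intro t ht
    refine ⟨Ioo 0 (t + 1), mem_nhdsWithin_of_mem_nhds (Ioo_mem_nhds ht (by linarith)), ?_⟩
    have h1 : (0 : ℝ) < t + 1 := by linarith [mem_Ioi.1 ht]
    exact (H.locL2.integrableOn_stconv hρ'c x h1).sub
      ((H.locL2_grad k).integrableOn_stconv hρc x h1)
  have key := isOpen_Ioi.ae_eq_zero_of_integral_contDiff_smul_eq_zero hloc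
    (fun η hη hc hs => ?_)
  · rw [ae_restrict_iff' measurableSet_Ioi]
    filter_upwards [key] with t ht h0
    exact sub_eq_zero.1 (ht h0)
  obtain ⟨T, hT0, hT⟩ := exists_timeSupp_of_hasCompactSupport hc
  -- The kernel is evaluated at `x - y`, so its gradient in `y` carries a minus sign, which cancels
  -- the one in the definition of the weak gradient.
  have e := H.grad _ (isTestFunction_prodTest hη hc hρ x) (tsupport_prodTest_subset hs x) k
  simp only [spaceGrad_prodTest hρ, mul_neg, integral_neg, neg_inj] at e
  simp only [prodTest] at e
  rw [H.locL2.integral_cyl_mul_kernel hρ'c hη.continuous hT0 (fun t ht => (hT t ht).1),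
    (H.locL2_grad k).integral_cyl_mul_kernel hρc hη.continuous hT0 (fun t ht => (hT t ht).1)] at e
  have hint : ∀ {κ : T3 → ℝ} {f : ℝ × T3 → ℝ}, Continuous κ → LocL2 f →
      IntegrableOn (fun t => η t * stconv κ f (t, x)) (Ioi 0) := by
    intro κ f hκ hf
    have h1 : IntegrableOn (fun t => η t * stconv κ f (t, x)) (Ioo 0 T) := by
      obtain ⟨C, hC⟩ := hc.exists_bound_of_continuous hη.continuous
      exact (hf.integrableOn_stconv hκ x hT0).bdd_mul (c := C)
        hη.continuous.aestronglyMeasurable (Eventually.of_forall hC)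
    refine h1.of_forall_sdiff_eq_zero measurableSet_Ioi fun t ht => ?_
    rw [(hT t ?_).1, zero_mul]
    by_contra hlt
    rw [abs_of_pos ht.1] at hlt
    exact ht.2 ⟨ht.1, not_le.1 hlt⟩
  rw [← setIntegral_eq_integral_of_forall_compl_eq_zero (s := Ioi 0) (fun t ht => by
    rw [image_eq_zero_of_notMem_tsupport fun h => ht (hs h), zero_smul])]
  simp only [smul_eq_mul, mul_sub]
  rw [integral_sub (hint hρ'c H.locL2) (hint hρc (H.locL2_grad k)), e, sub_self]

end IsWeakSolution

/-- The divergence of the mollification of `-J`, which is the time derivative of the mollified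
solution. -/
def mollRate (ρ : T3 → ℝ) (J : Fin 3 → ℝ × T3 → ℝ) (p : ℝ × T3) : ℝ :=
  -∑ k, stconv (fun x => torusGrad ρ x k) (J k) p

/-- The time-continuous version of the mollified solution. -/
def mollSol (ρ : T3 → ℝ) (c₀ : T3 → ℝ) (J : Fin 3 → ℝ × T3 → ℝ) (t : ℝ) (x : T3) : ℝ :=
  tconv ρ c₀ x + ∫ s in (0 : ℝ)..t, mollRate ρ J (s, x)

namespace IsWeakSolution

variable {c₀ : T3 → ℝ} {c : ℝ × T3 → ℝ} {h J : Fin 3 → ℝ × T3 → ℝ} {ρ : T3 → ℝ}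

theorem integrableOn_mollRate (H : IsWeakSolution c₀ c h J) (hρ : IsMollifier ρ) (x : T3)
    {T : ℝ} (hT : 0 < T) : IntegrableOn (fun t => mollRate ρ J (t, x)) (Ioo 0 T) :=
  (integrable_finsetSum _ fun k _ =>
    (H.locL2_flux k).integrableOn_stconv (hρ.continuous_torusGrad k) x hT).neg

theorem stronglyMeasurable_mollRate (H : IsWeakSolution c₀ c h J) (hρ : IsMollifier ρ) :
    StronglyMeasurable (mollRate ρ J) :=
  (Finset.stronglyMeasurable_fun_sum _ fun k _ =>
    stronglyMeasurable_stconv (hρ.continuous_torusGrad k) (H.locL2_flux k).meas).neg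

/-- Testing the equation with `η(t) ρ(x - y)` turns it into a weak ordinary differential equation at
the fixed point `x`, with its initial condition built in. -/
theorem ae_stconv_eq_mollSol (H : IsWeakSolution c₀ c h J) (hρ : IsMollifier ρ) (x : T3) :
    ∀ᵐ t ∂(volume.restrict (Ioi (0 : ℝ))), stconv ρ c (t, x) = mollSol ρ c₀ J t x := by
  refine ae_eq_of_weak_deriv (fun T hT => H.locL2.integrableOn_stconv hρ.continuous x hT)
    (fun T hT => H.integrableOn_mollRate hρ x hT) fun η hη hc => ?_
  obtain ⟨T, hT0, hT⟩ := exists_timeSupp_of_hasCompactSupport hc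
  have e := H.eqn _ (isTestFunction_prodTest hη hc hρ x)
  simp only [spaceGrad_prodTest hρ, timeDeriv_prodTest hη, mul_neg, integral_neg] at e
  rw [H.locL2.integral_cyl_mul_kernel hρ.continuous (hη.continuous_deriv (by simp)) hT0
    (fun t ht => (hT t ht).2)] at e
  simp only [fun k => (H.locL2_flux k).integral_cyl_mul_kernel (hρ.continuous_torusGrad k)
    hη.continuous hT0 (fun t ht => (hT t ht).1)] at e
  have h0 : ∫ y, c₀ y * prodTest η ρ x (0, y) = tconv ρ c₀ x * η 0 := by
    rw [tconv, ← integral_mul_const]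
    exact integral_congr_ae (Eventually.of_forall fun y => by simp only [prodTest]; ring)
  have hint : ∀ k, IntegrableOn (fun t => η t * stconv (fun x => torusGrad ρ x k) (J k) (t, x))
      (Ioi 0) := by
    intro k
    have h1 : IntegrableOn (fun t => η t * stconv (fun x => torusGrad ρ x k) (J k) (t, x))
        (Ioo 0 T) := by
      obtain ⟨C, hC⟩ := hc.exists_bound_of_continuous hη.continuous
      exact ((H.locL2_flux k).integrableOn_stconv (hρ.continuous_torusGrad k) x hT0).bdd_mul
        (c := C) hη.continuous.aestronglyMeasurable (Eventually.of_forall hC)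
    refine h1.of_forall_sdiff_eq_zero measurableSet_Ioi fun t ht => ?_
    rw [(hT t ?_).1, zero_mul]
    by_contra hlt
    rw [abs_of_pos ht.1] at hlt
    exact ht.2 ⟨ht.1, not_le.1 hlt⟩
  have h1 : ∫ t in Ioi (0 : ℝ), η t * mollRate ρ J (t, x)
      = ∑ k, -∫ t in Ioi (0 : ℝ), η t * stconv (fun x => torusGrad ρ x k) (J k) (t, x) := by
    rw [Finset.sum_neg_distrib, ← integral_finsetSum _ fun k _ => hint k, ← integral_neg]
    exact integral_congr_ae (Eventually.of_forall fun t => by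
      simp only [mollRate, mul_neg, Finset.mul_sum])
  rw [h1, ← h0]
  exact e

end IsWeakSolution

/-! ### The energy identity for mollified solutions -/

/-- For kernels such as `torusGrad ρ`, which are not probability densities. The supremum of the
kernel times the `L¹` norm of the time slice is a sufficient majorant. -/
theorem integrable_stconv_of_continuous {f : ℝ × T3 → ℝ} (hf : LocL2 f) {κ : T3 → ℝ}
    (hκ : Continuous κ) {T : ℝ} (hT : 0 < T) :
    Integrable (stconv κ f) ((volume.restrict (Ioo 0 T)).prod volume) := by
  obtain ⟨C, -, hC⟩ := exists_bound_torus hκ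
  have h1 := (hf.memLp T hT).integrable one_le_two
  have h2 : Integrable (fun p : ℝ × T3 => C * ∫ y, ‖f (p.1, y)‖)
      ((volume.restrict (Ioo 0 T)).prod volume) :=
    (h1.norm.integral_prod_left.comp_fst volume).const_mul C
  refine h2.mono' (stronglyMeasurable_stconv hκ hf.meas).aestronglyMeasurable ?_
  filter_upwards [(Measure.quasiMeasurePreserving_fst (μ := volume.restrict (Ioo 0 T))
    (ν := (volume : Measure T3))).ae h1.prod_right_ae] with p hp
  rw [← integral_const_mul]
  refine norm_integral_le_of_norm_le (hp.norm.const_mul C) (Eventually.of_forall fun y => ?_)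
  rw [norm_mul]
  exact mul_le_mul_of_nonneg_right (hC _) (norm_nonneg _)

theorem ae_integrable_slice {f : ℝ × T3 → ℝ} (hf : LocL2 f) {T : ℝ} (hT : 0 < T) :
    ∀ᵐ t ∂(volume.restrict (Ioo 0 T)), Integrable fun y => f (t, y) :=
  ((hf.memLp T hT).integrable one_le_two).prod_right_ae

section Pair

variable {c₀ c₀' : T3 → ℝ} {c c' : ℝ × T3 → ℝ} {h J h' J' : Fin 3 → ℝ × T3 → ℝ} {ρ ρ' : T3 → ℝ}
  {Φ Φ₁ Φ₂ : ℝ × ℝ → ℝ} {T : ℝ}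

theorem integrable_comp_stconv_mul (H : IsWeakSolution c₀ c h J)
    (H' : IsWeakSolution c₀' c' h' J') (hρ : IsMollifier ρ) (hρ' : IsMollifier ρ')
    (hΦ : Continuous Φ) {μ : Measure (ℝ × T3)} {g : ℝ × T3 → ℝ} (hg : Integrable g μ) :
    Integrable (fun p => Φ (stconv ρ c p, stconv ρ' c' p) * g p) μ := by
  obtain ⟨C, -, hC⟩ := exists_bound_Icc hΦ
  refine hg.bdd_mul (c := C) ?_
    (Eventually.of_forall fun p => hC _ (H.stconv_mem hρ p) _ (H'.stconv_mem hρ' p))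
  exact (hΦ.comp_stronglyMeasurable ((stronglyMeasurable_stconv hρ.continuous H.meas).prodMk
    (stronglyMeasurable_stconv hρ'.continuous H'.meas))).aestronglyMeasurable

theorem memLp_comp_stconv_mul (H : IsWeakSolution c₀ c h J)
    (H' : IsWeakSolution c₀' c' h' J') (hρ : IsMollifier ρ) (hρ' : IsMollifier ρ')
    (hΦ : Continuous Φ) {μ : Measure (ℝ × T3)} {g : ℝ × T3 → ℝ} (hg : MemLp g 2 μ) :
    MemLp (fun p => Φ (stconv ρ c p, stconv ρ' c' p) * g p) 2 μ :=
  memLp_comp_mul hΦ (stronglyMeasurable_stconv hρ.continuous H.meas).aestronglyMeasurable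
    (stronglyMeasurable_stconv hρ'.continuous H'.meas).aestronglyMeasurable
    (Eventually.of_forall fun p => H.stconv_mem hρ p)
    (Eventually.of_forall fun p => H'.stconv_mem hρ' p) hg

/-- Integration by parts in space for a function of two mollified solutions. -/
theorem integral_comp_stconv_mul_deriv (H : IsWeakSolution c₀ c h J)
    (H' : IsWeakSolution c₀' c' h' J') (hρ : IsMollifier ρ) (hρ' : IsMollifier ρ')
    (hΦ : HasPartials Φ Φ₁ Φ₂) (hT : 0 < T) {k : Fin 3} {Q Q' : ℝ × T3 → ℝ}
    (hQ2 : MemLp Q 2 ((volume.restrict (Ioo 0 T)).prod volume))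
    (hQ' : Integrable Q' ((volume.restrict (Ioo 0 T)).prod volume))
    (hQ : ∀ᵐ t ∂(volume.restrict (Ioo 0 T)), Continuous (fun x => Q (t, x)) ∧
      Continuous (fun x => Q' (t, x)) ∧
      HasTorusDeriv k (fun x => Q (t, x)) (fun x => Q' (t, x))) :
    ∫ p, Φ (stconv ρ c p, stconv ρ' c' p) * Q' p ∂(volume.restrict (Ioo 0 T)).prod volume
      = -∫ p, (Φ₁ (stconv ρ c p, stconv ρ' c' p) * stconv ρ (h k) p
          + Φ₂ (stconv ρ c p, stconv ρ' c' p) * stconv ρ' (h' k) p) * Q p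
          ∂(volume.restrict (Ioo 0 T)).prod volume := by
  have hi1 := integrable_comp_stconv_mul H H' hρ hρ' hΦ.continuous hQ'
  have hi2 : Integrable (fun p => (Φ₁ (stconv ρ c p, stconv ρ' c' p) * stconv ρ (h k) p
      + Φ₂ (stconv ρ c p, stconv ρ' c' p) * stconv ρ' (h' k) p) * Q p)
      ((volume.restrict (Ioo 0 T)).prod volume) :=
    ((memLp_comp_stconv_mul H H' hρ hρ' hΦ.continuous_fst
      (memLp_stconv hρ (H.locL2_grad k).meas ((H.locL2_grad k).memLp T hT))).add
    (memLp_comp_stconv_mul H H' hρ hρ' hΦ.continuous_snd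
      (memLp_stconv hρ' (H'.locL2_grad k).meas ((H'.locL2_grad k).memLp T hT)))).integrable_mul hQ2
  have hsub : (volume.restrict (Ioo (0 : ℝ) T)) ≤ volume.restrict (Ioi 0) :=
    Measure.restrict_mono Ioo_subset_Ioi_self le_rfl
  rw [integral_prod _ hi1, integral_prod _ hi2, ← integral_neg]
  refine integral_congr_ae ?_
  filter_upwards [hQ, (Measure.ae_ae_of_ae_prod (H.ae_stconv_grad hρ k)).filter_mono
    (ae_mono hsub), (Measure.ae_ae_of_ae_prod (H'.ae_stconv_grad hρ' k)).filter_mono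
    (ae_mono hsub)] with t ht h1 h2
  have hc := H.integrable_slice t
  have hc' := H'.integrable_slice t
  have d1 := (hρ.hasTorusDeriv k).tconv hρ.continuous (hρ.continuous_torusGrad k) hc
  have d2 := (hρ'.hasTorusDeriv k).tconv hρ'.continuous (hρ'.continuous_torusGrad k) hc'
  have k1 := continuous_tconv hρ.continuous hc
  have k2 := continuous_tconv hρ'.continuous hc'
  have k1' := continuous_tconv (hρ.continuous_torusGrad k) hc
  have k2' := continuous_tconv (hρ'.continuous_torusGrad k) hc'
  have a0 := hΦ.continuous
  have a1 := hΦ.continuous_fst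
  have a2 := hΦ.continuous_snd
  have := (hΦ.hasTorusDeriv d1 d2).integral_mul_eq ht.2.2 (by fun_prop) (by fun_prop) ht.1 ht.2.1
  refine Eq.trans this (congrArg Neg.neg (integral_congr_ae ?_))
  filter_upwards [h1, h2] with x e1 e2
  rw [← e1, ← e2]
  rfl

/-- As `mollRate` is minus a divergence, the sign of the integration by parts cancels. No derivative
of the kernel remains on the right, so that side survives the removal of the mollifier. -/
theorem integral_comp_stconv_mul_mollRate (H : IsWeakSolution c₀ c h J)
    (H' : IsWeakSolution c₀' c' h' J') (hρ : IsMollifier ρ) (hρ' : IsMollifier ρ')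
    (hΦ : HasPartials Φ Φ₁ Φ₂) (hT : 0 < T) {σ : T3 → ℝ} (hσ : IsMollifier σ)
    {I : Fin 3 → ℝ × T3 → ℝ} (hI : ∀ k, LocL2 (I k)) :
    ∫ p, Φ (stconv ρ c p, stconv ρ' c' p) * mollRate σ I p
        ∂(volume.restrict (Ioo 0 T)).prod volume
      = ∑ k, ∫ p, (Φ₁ (stconv ρ c p, stconv ρ' c' p) * stconv ρ (h k) p
          + Φ₂ (stconv ρ c p, stconv ρ' c' p) * stconv ρ' (h' k) p) * stconv σ (I k) p
          ∂(volume.restrict (Ioo 0 T)).prod volume := by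
  have hQ' := fun k => integrable_stconv_of_continuous (hI k) (hσ.continuous_torusGrad k) hT
  simp only [mollRate, mul_neg, Finset.mul_sum]
  rw [integral_neg, integral_finsetSum _ fun k _ =>
    integrable_comp_stconv_mul H H' hρ hρ' hΦ.continuous (hQ' k), ← Finset.sum_neg_distrib]
  refine Finset.sum_congr rfl fun k _ => ?_
  rw [integral_comp_stconv_mul_deriv H H' hρ hρ' hΦ hT
    (memLp_stconv hσ (hI k).meas ((hI k).memLp T hT)) (hQ' k), neg_neg]
  filter_upwards [ae_integrable_slice (hI k) hT] with t ht
  exact ⟨continuous_tconv hσ.continuous ht, continuous_tconv (hσ.continuous_torusGrad k) ht,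
    (hσ.hasTorusDeriv k).tconv hσ.continuous (hσ.continuous_torusGrad k) ht⟩

variable {F F₁ F₂ F₁₁ F₁₂ F₂₁ F₂₂ : ℝ × ℝ → ℝ}

theorem IsWeakSolution.integrable_mollRate (H : IsWeakSolution c₀ c h J) (hρ : IsMollifier ρ)
    (hT : 0 < T) : Integrable (mollRate ρ J) ((volume.restrict (Ioo 0 T)).prod volume) :=
  (integrable_finsetSum _ fun k _ => integrable_stconv_of_continuous (H.locL2_flux k)
    (hρ.continuous_torusGrad k) hT).neg

theorem IsWeakSolution.tconv_init_mem (H : IsWeakSolution c₀ c h J) (hρ : IsMollifier ρ) (x : T3) :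
    tconv ρ c₀ x ∈ Icc (0 : ℝ) 1 :=
  hρ.tconv_mem_Icc H.meas_init.aestronglyMeasurable H.init_mem x

/-- The energy identity for a pair of mollified solutions. -/
theorem energy_mollSol (H : IsWeakSolution c₀ c h J)
    (H' : IsWeakSolution c₀' c' h' J') (hρ : IsMollifier ρ) (hρ' : IsMollifier ρ')
    (hF : HasPartials F F₁ F₂) (hF₁ : HasPartials F₁ F₁₁ F₁₂) (hF₂ : HasPartials F₂ F₂₁ F₂₂)
    (hT : 0 < T) :
    (∫ x, F (mollSol ρ c₀ J T x, mollSol ρ' c₀' J' T x))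
        = (∫ x, F (tconv ρ c₀ x, tconv ρ' c₀' x))
      + ∑ k, ((∫ p, (F₁₁ (stconv ρ c p, stconv ρ' c' p) * stconv ρ (h k) p
          + F₁₂ (stconv ρ c p, stconv ρ' c' p) * stconv ρ' (h' k) p) * stconv ρ (J k) p
          ∂(volume.restrict (Ioo 0 T)).prod volume)
        + ∫ p, (F₂₁ (stconv ρ c p, stconv ρ' c' p) * stconv ρ (h k) p
          + F₂₂ (stconv ρ c p, stconv ρ' c' p) * stconv ρ' (h' k) p) * stconv ρ' (J' k) p
          ∂(volume.restrict (Ioo 0 T)).prod volume) := by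
  have i1 := integrable_comp_stconv_mul H H' hρ hρ' hF₁.continuous (H.integrable_mollRate hρ hT)
  have i2 := integrable_comp_stconv_mul H H' hρ hρ' hF₂.continuous (H'.integrable_mollRate hρ' hT)
  have i3 : Integrable (fun p => F₁ (stconv ρ c p, stconv ρ' c' p) * mollRate ρ J p
      + F₂ (stconv ρ c p, stconv ρ' c' p) * mollRate ρ' J' p)
      ((volume.restrict (Ioo 0 T)).prod volume) := i1.add i2
  -- Under the time integral the continuous version may be replaced by `stconv`, with which it
  -- agrees for almost all times; at the single time `T` it must be kept.
  have hpt : ∀ x, F (mollSol ρ c₀ J T x, mollSol ρ' c₀' J' T x)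
      = F (tconv ρ c₀ x, tconv ρ' c₀' x)
        + ∫ t in Ioo 0 T, (F₁ (stconv ρ c (t, x), stconv ρ' c' (t, x)) * mollRate ρ J (t, x)
          + F₂ (stconv ρ c (t, x), stconv ρ' c' (t, x)) * mollRate ρ' J' (t, x)) := by
    intro x
    have h1 := hF.integral_chain (intervalIntegrable_of_Ioo hT.le (H.integrableOn_mollRate hρ x hT))
      (intervalIntegrable_of_Ioo hT.le (H'.integrableOn_mollRate hρ' x hT))
      (tconv ρ c₀ x) (tconv ρ' c₀' x) (f := fun t => mollSol ρ c₀ J t x)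
      (g := fun t => mollSol ρ' c₀' J' t x) (fun t => rfl) (fun t => rfl)
    rw [intervalIntegral.integral_of_le hT.le, integral_Ioc_eq_integral_Ioo] at h1
    rw [← sub_eq_iff_eq_add', h1]
    have hsub : (volume.restrict (Ioo (0 : ℝ) T)) ≤ volume.restrict (Ioi 0) :=
      Measure.restrict_mono Ioo_subset_Ioi_self le_rfl
    refine integral_congr_ae ?_
    filter_upwards [(H.ae_stconv_eq_mollSol hρ x).filter_mono (ae_mono hsub),
      (H'.ae_stconv_eq_mollSol hρ' x).filter_mono (ae_mono hsub)] with t e1 e2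
    rw [e1, e2]
  have k1 := continuous_tconv hρ.continuous (H.memLp_init.integrable one_le_two)
  have k2 := continuous_tconv hρ'.continuous (H'.memLp_init.integrable one_le_two)
  have k0 := hF.continuous
  have hi0 : Integrable fun x => F (tconv ρ c₀ x, tconv ρ' c₀' x) :=
    (by fun_prop : Continuous fun x => F (tconv ρ c₀ x, tconv ρ' c₀' x)
      ).integrable_of_hasCompactSupport (.of_compactSpace _)
  simp only [hpt]
  rw [integral_add hi0 i3.integral_prod_right, ← integral_prod_symm _ i3]
  congr 1
  rw [integral_add i1 i2, integral_comp_stconv_mul_mollRate H H' hρ hρ' hF₁ hT hρ H.locL2_flux,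
    integral_comp_stconv_mul_mollRate H H' hρ hρ' hF₂ hT hρ' H'.locL2_flux,
    ← Finset.sum_add_distrib]

end Pair

/-! ### Continuity in time -/

/-- The sum of the squared errors made by mollification up to time `S`. -/
def mollError (c₀ : T3 → ℝ) (h J : Fin 3 → ℝ × T3 → ℝ) (S : ℝ) (N : ℕ) : ℝ :=
  (∫ x, (tconv (moll N) c₀ x - c₀ x) ^ 2)
    + ∑ k, ((∫ p, (stconv (moll N) (h k) p - h k p) ^ 2 ∂(volume.restrict (Ioo 0 S)).prod volume)
      + ∫ p, (stconv (moll N) (J k) p - J k p) ^ 2 ∂(volume.restrict (Ioo 0 S)).prod volume)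

theorem integral_sub_sq_le {α : Type*} [MeasurableSpace α] {μ : Measure α}
    {a b f : α → ℝ} (ha : MemLp a 2 μ) (hb : MemLp b 2 μ) (hf : MemLp f 2 μ) :
    ∫ x, (a x - b x) ^ 2 ∂μ ≤ 2 * (∫ x, (a x - f x) ^ 2 ∂μ) + 2 * ∫ x, (b x - f x) ^ 2 ∂μ := by
  have i1 : Integrable (fun x => (a x - f x) ^ 2) μ := (ha.sub hf).integrable_sq
  have i2 : Integrable (fun x => (b x - f x) ^ 2) μ := (hb.sub hf).integrable_sq
  have i3 : Integrable (fun x => (a x - b x) ^ 2) μ := (ha.sub hb).integrable_sq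
  rw [← integral_const_mul, ← integral_const_mul,
    ← integral_add (i1.const_mul 2) (i2.const_mul 2)]
  refine integral_mono i3 ((i1.const_mul 2).add (i2.const_mul 2)) fun x => ?_
  change (a x - b x) ^ 2 ≤ 2 * (a x - f x) ^ 2 + 2 * (b x - f x) ^ 2
  nlinarith [sq_nonneg (a x - f x + (b x - f x))]

section Continuity

variable {c₀ : T3 → ℝ} {c : ℝ × T3 → ℝ} {h J : Fin 3 → ℝ × T3 → ℝ} {ρ : T3 → ℝ}

namespace IsWeakSolution

/-- The bounds hold for almost every time through `stconv`; continuity in time of the function and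
of its truncation extends them to every time. -/
theorem mollSol_mem (H : IsWeakSolution c₀ c h J) (hρ : IsMollifier ρ) {t : ℝ} (ht : 0 ≤ t)
    (x : T3) : mollSol ρ c₀ J t x ∈ Icc (0 : ℝ) 1 := by
  have hc : ContinuousOn (fun s => mollSol ρ c₀ J s x) (Ici 0) :=
    continuousOn_const.add (continuousOn_integral_of_Ioo fun T hT => H.integrableOn_mollRate hρ x hT)
  have heq : (fun s => mollSol ρ c₀ J s x) =ᵐ[volume.restrict (Ici (0 : ℝ))]
      fun s => max 0 (min 1 (mollSol ρ c₀ J s x)) := by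
    rw [← Measure.restrict_congr_set Ioi_ae_eq_Ici]
    filter_upwards [H.ae_stconv_eq_mollSol hρ x] with s hs
    have := H.stconv_mem hρ (s, x)
    rw [← hs, min_eq_right this.2, max_eq_right this.1]
  have := Measure.eqOn_of_ae_eq heq hc (by fun_prop) (by rw [interior_Ici, closure_Ioi]) ht
  simp only at this
  rw [this]
  exact ⟨le_max_left _ _, max_le zero_le_one (min_le_left _ _)⟩

theorem aestronglyMeasurable_mollSol (H : IsWeakSolution c₀ c h J) (hρ : IsMollifier ρ) {t : ℝ}
    (ht : 0 ≤ t) : AEStronglyMeasurable (mollSol ρ c₀ J t) volume := by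
  have k1 := continuous_tconv hρ.continuous (H.memLp_init.integrable one_le_two)
  refine k1.aestronglyMeasurable.add ?_
  simp only [intervalIntegral.integral_of_le ht]
  exact (H.stronglyMeasurable_mollRate hρ).integral_prod_left'.aestronglyMeasurable

theorem memLp_mollSol (H : IsWeakSolution c₀ c h J) (hρ : IsMollifier ρ) {t : ℝ} (ht : 0 ≤ t) :
    MemLp (mollSol ρ c₀ J t) 2 volume :=
  MemLp.of_bound (H.aestronglyMeasurable_mollSol hρ ht) 1 (Eventually.of_forall fun x => by
    rw [Real.norm_eq_abs, abs_of_nonneg (H.mollSol_mem hρ ht x).1]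
    exact (H.mollSol_mem hρ ht x).2)

theorem ae_ae_stconv_eq_mollSol (H : IsWeakSolution c₀ c h J) (hρ : IsMollifier ρ) :
    ∀ᵐ t ∂(volume.restrict (Ioi (0 : ℝ))), ∀ᵐ x : T3,
      stconv ρ c (t, x) = mollSol ρ c₀ J t x := by
  -- Writing the variable upper limit as an indicator makes joint measurability in `(x, t)`
  -- accessible, as needed to exchange "every `x`" with "almost every `t`".
  set w : T3 → ℝ → ℝ := fun x t =>
    tconv ρ c₀ x + ∫ s, (Ioc 0 t).indicator (fun s => mollRate ρ J (s, x)) s with hw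
  have hwm : ∀ {t : ℝ}, 0 < t → ∀ x, mollSol ρ c₀ J t x = w x t := fun {t} ht x => by
    rw [hw, mollSol, intervalIntegral.integral_of_le ht.le]
    simp only
    rw [integral_indicator measurableSet_Ioc]
  have k1 := continuous_tconv hρ.continuous (H.memLp_init.integrable one_le_two)
  have hm : StronglyMeasurable fun q : T3 × ℝ => w q.1 q.2 := by
    refine (k1.comp continuous_fst).stronglyMeasurable.add ?_
    have hset : MeasurableSet {r : (T3 × ℝ) × ℝ | r.2 ∈ Ioc 0 r.1.2} :=
      (measurableSet_lt measurable_const measurable_snd).inter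
        (measurableSet_le measurable_snd (measurable_snd.comp measurable_fst))
    have h1 : StronglyMeasurable ({r : (T3 × ℝ) × ℝ | r.2 ∈ Ioc 0 r.1.2}.indicator
        fun r => mollRate ρ J (r.2, r.1.1)) :=
      ((H.stronglyMeasurable_mollRate hρ).comp_measurable (by fun_prop)).indicator hset
    exact h1.integral_prod_right'
  have hms : MeasurableSet {q : T3 × ℝ | stconv ρ c (q.2, q.1) = w q.1 q.2} :=
    measurableSet_eq_fun ((stronglyMeasurable_stconv hρ.continuous H.meas).comp_measurable
      measurable_swap).measurable hm.measurable
  have h1 := (Measure.ae_ae_comm (μ := (volume : Measure T3))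
    (ν := volume.restrict (Ioi (0 : ℝ))) (p := fun x t => stconv ρ c (t, x) = w x t) hms).1
    (Eventually.of_forall fun x => by
      filter_upwards [H.ae_stconv_eq_mollSol hρ x, self_mem_ae_restrict measurableSet_Ioi]
        with t ht ht0
      rw [ht, hwm ht0])
  filter_upwards [h1, self_mem_ae_restrict measurableSet_Ioi] with t ht ht0
  filter_upwards [ht] with x hx
  rw [hx, hwm ht0]

/-- Mollified solutions are continuous in time, uniformly in space. -/
theorem exists_modulus_mollSol (H : IsWeakSolution c₀ c h J) (hρ : IsMollifier ρ) :
    ∃ B : ℝ → ℝ, ContinuousOn B (Ici 0) ∧ ∀ s t, 0 ≤ s → 0 ≤ t → ∀ x,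
      |mollSol ρ c₀ J t x - mollSol ρ c₀ J s x| ≤ |B t - B s| := by
  choose C hC0 hC using fun k => exists_bound_torus (hρ.continuous_torusGrad k)
  -- A bound for the time derivative that is uniform in `x`: supremum of the kernel gradient times
  -- the `L¹` norm of the flux. The modulus `B` is its primitive.
  set b : ℝ → ℝ := fun t => ∑ k, C k * ∫ y, ‖J k (t, y)‖ with hb
  have hbi : ∀ T > 0, IntegrableOn b (Ioo 0 T) := fun T hT =>
    integrable_finsetSum _ fun k _ => (((H.locL2_flux k).memLp T hT).integrable
      one_le_two).norm.integral_prod_left.const_mul (C k)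
  have hle : ∀ T > 0, ∀ᵐ t ∂(volume.restrict (Ioo 0 T)), ∀ x, |mollRate ρ J (t, x)| ≤ b t := by
    intro T hT
    filter_upwards [ae_all_iff.2 fun k => ae_integrable_slice (H.locL2_flux k) hT] with t ht x
    rw [mollRate, abs_neg]
    refine (Finset.abs_sum_le_sum_abs _ _).trans (Finset.sum_le_sum fun k _ => ?_)
    rw [← integral_const_mul, ← Real.norm_eq_abs]
    refine norm_integral_le_of_norm_le ((ht k).norm.const_mul (C k))
      (Eventually.of_forall fun y => ?_)
    rw [norm_mul]
    exact mul_le_mul_of_nonneg_right (hC k _) (norm_nonneg _)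
  have main : ∀ s t, 0 ≤ s → s ≤ t → ∀ x, |mollSol ρ c₀ J t x - mollSol ρ c₀ J s x|
      ≤ |(∫ r in (0 : ℝ)..t, b r) - ∫ r in (0 : ℝ)..s, b r| := by
    intro s t hs hst x
    have hsub : Ioc s t ⊆ Ioc 0 (t + 1) := Ioc_subset_Ioc hs (by linarith)
    have ht1 : 0 < t + 1 := by linarith
    have ii : ∀ {f : ℝ → ℝ}, (∀ T > 0, IntegrableOn f (Ioo 0 T)) → ∀ r, 0 ≤ r →
        IntervalIntegrable f volume 0 r := fun {f} hf r hr =>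
      (intervalIntegrable_of_Ioo (by linarith) (hf (r + 1) (by linarith))).mono_set (by
        rw [uIcc_of_le hr, uIcc_of_le (by linarith : (0 : ℝ) ≤ r + 1)]
        exact Icc_subset_Icc_right (by linarith))
    have hj := fun T (hT : T > 0) => H.integrableOn_mollRate hρ x hT
    have e : mollSol ρ c₀ J t x - mollSol ρ c₀ J s x
        = ∫ r in s..t, mollRate ρ J (r, x) := by
      rw [mollSol, mollSol, add_sub_add_left_eq_sub, intervalIntegral.integral_interval_sub_left
        (ii hj t (hs.trans hst)) (ii hj s hs)]
    rw [e, intervalIntegral.integral_interval_sub_left (ii hbi t (hs.trans hst)) (ii hbi s hs)]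
    refine le_trans ?_ (le_abs_self _)
    rw [← Real.norm_eq_abs]
    refine intervalIntegral.norm_integral_le_of_norm_le hst ?_
      ((ii hbi s hs).symm.trans (ii hbi t (hs.trans hst)))
    have h1 := (ae_restrict_iff' measurableSet_Ioo).1 (hle (t + 1) ht1)
    filter_upwards [h1] with r hr hr2
    exact hr ⟨hs.trans_lt hr2.1, by linarith [hr2.2]⟩ x
  refine ⟨fun t => ∫ r in (0 : ℝ)..t, b r, continuousOn_integral_of_Ioo hbi, fun s t hs ht x => ?_⟩
  rcases le_total s t with hst | hst
  · exact main s t hs hst x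
  · rw [abs_sub_comm, abs_sub_comm (∫ r in (0 : ℝ)..t, b r)]
    exact main t s ht hst x

theorem tendsto_mollError (H : IsWeakSolution c₀ c h J) {S : ℝ} (hS : 0 < S) :
    Tendsto (mollError c₀ h J S) atTop (𝓝 0) := by
  have h1 := (tendstoL2_tconv H.memLp_init).tendsto
  have h2 := tendsto_finsetSum (Finset.univ : Finset (Fin 3)) fun k _ =>
    (tendstoL2_stconv (H.locL2_grad k).meas ((H.locL2_grad k).memLp S hS)).tendsto.add
      (tendstoL2_stconv (H.locL2_flux k).meas ((H.locL2_flux k).memLp S hS)).tendsto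
  have h3 := h1.add h2
  simp only [add_zero, Finset.sum_const_zero] at h3
  exact h3

/-- Mollified solutions with different mollifiers are close to each other. -/
theorem integral_mollSol_sub_sq_le (H : IsWeakSolution c₀ c h J) {S T : ℝ} (hT : 0 < T)
    (hTS : T ≤ S) (N M : ℕ) :
    ∫ x, (mollSol (moll N) c₀ J T x - mollSol (moll M) c₀ J T x) ^ 2
      ≤ 2 * (mollError c₀ h J S N + mollError c₀ h J S M) := by
  have hS := hT.trans_le hTS
  have hp : ∀ a b : ℝ, HasPartials (fun z => a * z.1 + b * z.2) (fun _ => a) (fun _ => b) :=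
    fun a b => ⟨fun z => by
      have h1 := (hasFDerivAt_fst (𝕜 := ℝ) (p := z)).const_mul a
      have h2 := (hasFDerivAt_snd (𝕜 := ℝ) (p := z)).const_mul b
      exact h1.add h2, continuous_const, continuous_const⟩
  -- The energy identity is used for one solution with two different mollifiers and the squared
  -- difference, whose second derivatives are constant.
  have hF : HasPartials (fun z => (z.1 - z.2) ^ 2) (fun z => 2 * z.1 + (-2) * z.2)
      (fun z => (-2) * z.1 + 2 * z.2) := by
    refine ⟨fun z => ?_, by fun_prop, by fun_prop⟩
    have h1 := ((hasFDerivAt_fst (𝕜 := ℝ) (p := z)).sub (hasFDerivAt_snd (𝕜 := ℝ) (p := z))).pow 2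
    refine h1.congr_fderiv ?_
    ext <;> simp <;> ring
  have key := energy_mollSol H H (isMollifier_moll N) (isMollifier_moll M) hF (hp _ _) (hp _ _) hT
  simp only at key
  rw [key, mollError, mollError]
  have m1 := integral_sub_sq_le (memLp_tconv (isMollifier_moll N) H.memLp_init)
    (memLp_tconv (isMollifier_moll M) H.memLp_init) H.memLp_init
  -- The integrands add up to `2 (h_N - h_M)(J_N - J_M)`, at most the sum of the two squares; being
  -- nonnegative, the squares may be integrated over the longer interval up to `S`.
  have m2 : ∀ k, (∫ p, (2 * stconv (moll N) (h k) p + (-2) * stconv (moll M) (h k) p)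
        * stconv (moll N) (J k) p ∂(volume.restrict (Ioo 0 T)).prod volume)
      + (∫ p, ((-2) * stconv (moll N) (h k) p + 2 * stconv (moll M) (h k) p)
        * stconv (moll M) (J k) p ∂(volume.restrict (Ioo 0 T)).prod volume)
      ≤ (∫ p, (stconv (moll N) (h k) p - stconv (moll M) (h k) p) ^ 2
          ∂(volume.restrict (Ioo 0 S)).prod volume)
        + ∫ p, (stconv (moll N) (J k) p - stconv (moll M) (J k) p) ^ 2
          ∂(volume.restrict (Ioo 0 S)).prod volume := by
    intro k
    have a1 := fun N {T : ℝ} (hT : 0 < T) => memLp_stconv (isMollifier_moll N)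
      (H.locL2_grad k).meas ((H.locL2_grad k).memLp T hT)
    have a2 := fun N {T : ℝ} (hT : 0 < T) => memLp_stconv (isMollifier_moll N)
      (H.locL2_flux k).meas ((H.locL2_flux k).memLp T hT)
    have hle : (volume.restrict (Ioo (0 : ℝ) T)).prod (volume : Measure T3)
        ≤ (volume.restrict (Ioo 0 S)).prod volume :=
      Measure.prod_mono (Measure.restrict_mono (Ioo_subset_Ioo_right hTS) le_rfl) le_rfl
    have i1 : Integrable (fun p => (2 * stconv (moll N) (h k) p
        + (-2) * stconv (moll M) (h k) p) * stconv (moll N) (J k) p)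
        ((volume.restrict (Ioo 0 T)).prod volume) :=
      (((a1 N hT).const_mul 2).add ((a1 M hT).const_mul (-2))).integrable_mul (a2 N hT)
    have i2 : Integrable (fun p => ((-2) * stconv (moll N) (h k) p
        + 2 * stconv (moll M) (h k) p) * stconv (moll M) (J k) p)
        ((volume.restrict (Ioo 0 T)).prod volume) :=
      (((a1 N hT).const_mul (-2)).add ((a1 M hT).const_mul 2)).integrable_mul (a2 M hT)
    have i3 : Integrable (fun p => (stconv (moll N) (h k) p - stconv (moll M) (h k) p) ^ 2)
        ((volume.restrict (Ioo 0 S)).prod volume) := ((a1 N hS).sub (a1 M hS)).integrable_sq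
    have i4 : Integrable (fun p => (stconv (moll N) (J k) p - stconv (moll M) (J k) p) ^ 2)
        ((volume.restrict (Ioo 0 S)).prod volume) := ((a2 N hS).sub (a2 M hS)).integrable_sq
    rw [← integral_add i1 i2, ← integral_add i3 i4]
    refine le_trans (integral_mono (i1.add i2) ((i3.add i4).mono_measure hle) fun p => ?_)
      (integral_mono_measure hle (Eventually.of_forall fun p => ?_) (i3.add i4))
    · simp only [Pi.add_apply]
      nlinarith [sq_nonneg (stconv (moll N) (h k) p - stconv (moll M) (h k) p
        - (stconv (moll N) (J k) p - stconv (moll M) (J k) p))]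
    · simp only [Pi.zero_apply, Pi.add_apply]
      positivity
  have m3 : ∀ k, (∫ p, (stconv (moll N) (h k) p - stconv (moll M) (h k) p) ^ 2
          ∂(volume.restrict (Ioo 0 S)).prod volume)
        + (∫ p, (stconv (moll N) (J k) p - stconv (moll M) (J k) p) ^ 2
          ∂(volume.restrict (Ioo 0 S)).prod volume)
      ≤ 2 * ((∫ p, (stconv (moll N) (h k) p - h k p) ^ 2
            ∂(volume.restrict (Ioo 0 S)).prod volume)
          + ∫ p, (stconv (moll N) (J k) p - J k p) ^ 2
            ∂(volume.restrict (Ioo 0 S)).prod volume)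
        + 2 * ((∫ p, (stconv (moll M) (h k) p - h k p) ^ 2
            ∂(volume.restrict (Ioo 0 S)).prod volume)
          + ∫ p, (stconv (moll M) (J k) p - J k p) ^ 2
            ∂(volume.restrict (Ioo 0 S)).prod volume) := by
    intro k
    have a1 := fun N => memLp_stconv (isMollifier_moll N)
      (H.locL2_grad k).meas ((H.locL2_grad k).memLp S hS)
    have a2 := fun N => memLp_stconv (isMollifier_moll N)
      (H.locL2_flux k).meas ((H.locL2_flux k).memLp S hS)
    linarith [integral_sub_sq_le (a1 N) (a1 M) ((H.locL2_grad k).memLp S hS),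
      integral_sub_sq_le (a2 N) (a2 M) ((H.locL2_flux k).memLp S hS)]
  have m4 := Finset.sum_le_sum fun k (_ : k ∈ (Finset.univ : Finset (Fin 3))) =>
    (m2 k).trans (m3 k)
  rw [Finset.sum_add_distrib (f := fun k => 2 * _), ← Finset.mul_sum, ← Finset.mul_sum] at m4
  linarith

open scoped Classical in
/-- A weak solution is continuous in time with values in `L²`, and it is the limit of its
mollifications at every time. -/
theorem exists_continuousVersion (H : IsWeakSolution c₀ c h J) :
    ∃ F : ℝ → Lp ℝ 2 (volume : Measure T3), IsContinuousVersion c F ∧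
      ∀ t > 0, TendstoL2 volume (fun N => mollSol (moll N) c₀ J t) (F t) := by
  set W : ℕ → ℝ → Lp ℝ 2 (volume : Measure T3) := fun N t =>
    if ht : 0 ≤ t then (H.memLp_mollSol (isMollifier_moll N) ht).toLp _ else 0 with hW
  have hWt : ∀ N t (ht : 0 ≤ t), W N t = (H.memLp_mollSol (isMollifier_moll N) ht).toLp _ :=
    fun N t ht => dif_pos ht
  have hWc : ∀ N, ContinuousOn (W N) (Ici 0) := by
    intro N
    obtain ⟨B, hBc, hB⟩ := H.exists_modulus_mollSol (isMollifier_moll N)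
    intro t ht
    rw [ContinuousWithinAt, tendsto_iff_norm_sub_tendsto_zero]
    have h1 : Tendsto (fun s => |B s - B t|) (𝓝[Ici 0] t) (𝓝 0) := by
      simpa using ((hBc t ht).sub_const (B t)).abs
    refine squeeze_zero' (Eventually.of_forall fun _ => norm_nonneg _) ?_ h1
    filter_upwards [self_mem_nhdsWithin] with s hs
    rw [hWt N s hs, hWt N t ht, ← MemLp.toLp_sub, Lp.norm_toLp]
    have h2 := eLpNorm_le_of_ae_bound (p := 2) (μ := (volume : Measure T3))
      (f := mollSol (moll N) c₀ J s - mollSol (moll N) c₀ J t) (C := |B s - B t|)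
      (Eventually.of_forall fun x => hB t s ht hs x)
    rw [measure_univ, ENNReal.one_rpow, one_mul] at h2
    exact ENNReal.toReal_le_of_le_ofReal (abs_nonneg _) h2
  have hdist : ∀ S > 0, ∀ N M, ∀ t ∈ Ioc 0 S, dist (W N t) (W M t)
      ≤ √(2 * (mollError c₀ h J S N + mollError c₀ h J S M)) := by
    intro S hS N M t ht
    refine Real.le_sqrt_of_sq_le ?_
    have h1 := H.integral_mollSol_sub_sq_le ht.1 ht.2 N M
    have h2 := integral_sq_eq_norm_sq ((H.memLp_mollSol (isMollifier_moll N) ht.1.le).sub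
      (H.memLp_mollSol (isMollifier_moll M) ht.1.le))
    rw [dist_eq_norm, hWt N t ht.1.le, hWt M t ht.1.le, ← MemLp.toLp_sub, ← h2]
    exact h1
  -- The energy identity is stated for positive times; continuity in time extends the estimate to `t
  -- = 0`.
  have hdist' : ∀ S > 0, ∀ N M, ∀ t ∈ Icc 0 S, dist (W N t) (W M t)
      ≤ √(2 * (mollError c₀ h J S N + mollError c₀ h J S M)) := by
    intro S hS N M t ht
    rw [← closure_Ioc hS.ne] at ht
    refine le_on_closure (fun s hs => hdist S hS N M s hs) ?_ continuousOn_const ht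
    rw [closure_Ioc hS.ne]
    exact continuous_dist.comp_continuousOn
      (((hWc N).mono Icc_subset_Ici_self).prodMk ((hWc M).mono Icc_subset_Ici_self))
  have hunif : ∀ S > 0, UniformCauchySeqOn W atTop (Icc 0 S) := by
    intro S hS
    rw [Metric.uniformCauchySeqOn_iff]
    intro ε hε
    have h1 := H.tendsto_mollError hS
    -- Two errors below `ε² / 4`, doubled, stay below `ε²`, and the distance is at most the square
    -- root.
    obtain ⟨N₀, hN₀⟩ := (h1.eventually_lt_const
      (show (0 : ℝ) < ε ^ 2 / 4 by positivity)).exists_forall_of_atTop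
    refine ⟨N₀, fun m hm n hn t ht => (hdist' S hS m n t ht).trans_lt ?_⟩
    rw [Real.sqrt_lt' hε]
    linarith [hN₀ m hm, hN₀ n hn]
  have hlim : ∀ t, ∃ F, 0 ≤ t → Tendsto (fun N => W N t) atTop (𝓝 F) := by
    intro t
    by_cases ht : 0 ≤ t
    · obtain ⟨F, hF⟩ := cauchySeq_tendsto_of_complete
        ((hunif (t + 1) (by linarith)).cauchySeq ⟨ht, by linarith⟩)
      exact ⟨F, fun _ => hF⟩
    · exact ⟨0, fun h => absurd h ht⟩
  choose F hF using hlim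
  have hTL : ∀ t, 0 ≤ t → TendstoL2 volume (fun N => mollSol (moll N) c₀ J t) (F t) := by
    intro t ht
    refine TendstoL2.of_tendsto_toLp (fun N => H.memLp_mollSol (isMollifier_moll N) ht)
      (Lp.memLp (F t)) ?_
    rw [Lp.toLp_coeFn]
    exact (hF t ht).congr fun N => hWt N t ht
  refine ⟨F, ⟨?_, ?_⟩, fun t ht => hTL t ht.le⟩
  · intro t ht
    have ht1 : 0 < t + 1 := by linarith [mem_Ici.1 ht]
    have hu : TendstoUniformlyOn W F atTop (Icc 0 (t + 1)) :=
      (hunif _ ht1).tendstoUniformlyOn_of_tendsto fun s hs => hF s hs.1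
    have h1 := hu.continuousOn (Eventually.of_forall fun N =>
      (hWc N).mono Icc_subset_Ici_self).frequently
    refine (h1 t ⟨ht, by linarith⟩).mono_of_mem_nhdsWithin ?_
    rw [← Ici_inter_Iic]
    exact inter_mem self_mem_nhdsWithin (mem_nhdsWithin_of_mem_nhds (Iic_mem_nhds (by linarith)))
  · have hae : ∀ N, ∀ᵐ t ∂(volume.restrict (Ioi (0 : ℝ))), ∀ᵐ x : T3,
        stconv (moll N) c (t, x) = mollSol (moll N) c₀ J t x :=
      fun N => H.ae_ae_stconv_eq_mollSol (isMollifier_moll N)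
    filter_upwards [ae_all_iff.2 hae, self_mem_ae_restrict measurableSet_Ioi] with t ht ht0
    have hc2 : MemLp (fun x => c (t, x)) 2 volume :=
      MemLp.of_bound (H.integrable_slice t).aestronglyMeasurable 1 (Eventually.of_forall fun x => by
        rw [Real.norm_eq_abs, abs_of_nonneg (H.mem _).1]; exact (H.mem _).2)
    have h1 := (tendstoL2_tconv hc2).tendsto_toLp
    have h2 := (hTL t (le_of_lt ht0)).tendsto_toLp
    -- At almost every time `mollSol` is the mollification of the slice `c(t, ·)`, which converges
    -- to that slice; uniqueness of limits identifies it with `F t`.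
    have h3 := tendsto_nhds_unique (h1.congr fun N => ?_) h2
    · have h4 := hc2.coeFn_toLp
      rw [h3, Lp.toLp_coeFn] at h4
      exact h4
    · exact MemLp.toLp_congr _ _ (ht N)

end IsWeakSolution

end Continuity

/-! ### The energy identity and the chain rule for weak solutions -/

theorem IsTestFunction.exists_timeSupp {φ : ℝ × T3 → ℝ} (hφ : IsTestFunction φ) :
    ∃ T > 0, TimeSupp T φ ∧ ∀ k, TimeSupp T fun p => spaceGrad φ p k := by
  obtain ⟨R, hR⟩ := (hφ.compact_support.isCompact.image continuous_fst).isBounded.subset_closedBall 0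
  have h0 : TimeSupp (max R 0 + 1) φ := by
    intro p hp
    refine image_eq_zero_of_notMem_tsupport fun h => ?_
    have := hR (mem_image_of_mem Prod.fst h)
    rw [Metric.mem_closedBall, dist_zero_right, Real.norm_eq_abs] at this
    have h3 := le_max_left R 0
    linarith
  refine ⟨max R 0 + 1, by positivity, h0, fun k p hp => ?_⟩
  simp [spaceGrad, torusGrad, fun y => h0 (p.1, y) hp]

theorem IsTestFunction.smooth_lift {φ : ℝ × T3 → ℝ} (hφ : IsTestFunction φ) :
    ContDiff ℝ ∞ fun p : ℝ × (Fin 3 → ℝ) => φ (p.1, torusMk p.2) := hφ.smooth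

section Pair

variable {c₀ c₀' : T3 → ℝ} {c c' : ℝ × T3 → ℝ} {h J h' J' : Fin 3 → ℝ × T3 → ℝ}
  {Φ Φ₁ Φ₂ : ℝ × ℝ → ℝ} {T : ℝ}

theorem tendstoL2_comp_stconv_mul (H : IsWeakSolution c₀ c h J)
    (H' : IsWeakSolution c₀' c' h' J') (hΦ : Continuous Φ) (hT : 0 < T)
    {u : ℕ → ℝ × T3 → ℝ} {v : ℝ × T3 → ℝ}
    (hu : TendstoL2 ((volume.restrict (Ioo 0 T)).prod volume) u v) :
    TendstoL2 ((volume.restrict (Ioo 0 T)).prod volume)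
      (fun N p => Φ (stconv (moll N) c p, stconv (moll N) c' p) * u N p)
      (fun p => Φ (c p, c' p) * v p) :=
  TendstoL2.comp_mul hΦ (tendstoL2_stconv H.meas (H.locL2.memLp T hT))
    (tendstoL2_stconv H'.meas (H'.locL2.memLp T hT)) hu
    (fun N => Eventually.of_forall fun p => H.stconv_mem (isMollifier_moll N) p)
    (fun N => Eventually.of_forall fun p => H'.stconv_mem (isMollifier_moll N) p)

theorem tendstoL2_gradient (H : IsWeakSolution c₀ c h J)
    (H' : IsWeakSolution c₀' c' h' J') (hΦ₁ : Continuous Φ₁) (hΦ₂ : Continuous Φ₂) (hT : 0 < T)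
    (k : Fin 3) : TendstoL2 ((volume.restrict (Ioo 0 T)).prod volume)
      (fun N p => Φ₁ (stconv (moll N) c p, stconv (moll N) c' p) * stconv (moll N) (h k) p
        + Φ₂ (stconv (moll N) c p, stconv (moll N) c' p) * stconv (moll N) (h' k) p)
      (fun p => Φ₁ (c p, c' p) * h k p + Φ₂ (c p, c' p) * h' k p) :=
  (tendstoL2_comp_stconv_mul H H' hΦ₁ hT
    (tendstoL2_stconv (H.locL2_grad k).meas ((H.locL2_grad k).memLp T hT))).add
  (tendstoL2_comp_stconv_mul H H' hΦ₂ hT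
    (tendstoL2_stconv (H'.locL2_grad k).meas ((H'.locL2_grad k).memLp T hT)))

/-- The torus has finite measure, so the constant `1` can serve both as the multiplied sequence and
as the partner in the product. -/
theorem tendsto_integral_comp {F : ℝ × ℝ → ℝ} (hF : Continuous F) {a b : ℕ → T3 → ℝ}
    {a₀ b₀ : T3 → ℝ} (ha : TendstoL2 volume a a₀) (hb : TendstoL2 volume b b₀)
    (ha01 : ∀ N x, a N x ∈ Icc (0 : ℝ) 1) (hb01 : ∀ N x, b N x ∈ Icc (0 : ℝ) 1) :
    Tendsto (fun N => ∫ x, F (a N x, b N x)) atTop (𝓝 (∫ x, F (a₀ x, b₀ x))) := by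
  have h1 : TendstoL2 (volume : Measure T3) (fun _ _ => (1 : ℝ)) (fun _ => 1) :=
    TendstoL2.const (memLp_const 1)
  have := (TendstoL2.comp_mul hF ha hb h1 (fun N => Eventually.of_forall (ha01 N))
    (fun N => Eventually.of_forall (hb01 N))).tendsto_integral_mul h1
  simpa using this

/-- The energy identity for a pair of weak solutions. -/
theorem energy_weakSolution (H : IsWeakSolution c₀ c h J)
    (H' : IsWeakSolution c₀' c' h' J') {F F₁ F₂ F₁₁ F₁₂ F₂₁ F₂₂ : ℝ × ℝ → ℝ}
    (hF : HasPartials F F₁ F₂) (hF₁ : HasPartials F₁ F₁₁ F₁₂) (hF₂ : HasPartials F₂ F₂₁ F₂₂)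
    (hT : 0 < T) {a b : T3 → ℝ}
    (ha : TendstoL2 volume (fun N => mollSol (moll N) c₀ J T) a)
    (hb : TendstoL2 volume (fun N => mollSol (moll N) c₀' J' T) b) :
    (∫ x, F (a x, b x)) = (∫ x, F (c₀ x, c₀' x))
      + ∑ k, ((∫ p, (F₁₁ (c p, c' p) * h k p + F₁₂ (c p, c' p) * h' k p) * J k p
          ∂(volume.restrict (Ioo 0 T)).prod volume)
        + ∫ p, (F₂₁ (c p, c' p) * h k p + F₂₂ (c p, c' p) * h' k p) * J' k p
          ∂(volume.restrict (Ioo 0 T)).prod volume) := by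
  have l1 := tendsto_integral_comp hF.continuous ha hb
    (fun N x => H.mollSol_mem (isMollifier_moll N) hT.le x)
    (fun N x => H'.mollSol_mem (isMollifier_moll N) hT.le x)
  have l2 := tendsto_integral_comp hF.continuous (tendstoL2_tconv H.memLp_init)
    (tendstoL2_tconv H'.memLp_init) (fun N x => H.tconv_init_mem (isMollifier_moll N) x)
    (fun N x => H'.tconv_init_mem (isMollifier_moll N) x)
  have l3 := fun k => (tendstoL2_gradient H H' hF₁.continuous_fst hF₁.continuous_snd hT
    k).tendsto_integral_mul (tendstoL2_stconv (H.locL2_flux k).meas ((H.locL2_flux k).memLp T hT))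
  have l4 := fun k => (tendstoL2_gradient H H' hF₂.continuous_fst hF₂.continuous_snd hT
    k).tendsto_integral_mul
      (tendstoL2_stconv (H'.locL2_flux k).meas ((H'.locL2_flux k).memLp T hT))
  have l5 := l2.add (tendsto_finsetSum (Finset.univ : Finset (Fin 3)) fun k _ =>
    (l3 k).add (l4 k))
  refine tendsto_nhds_unique l1 (l5.congr fun N => ?_)
  exact (energy_mollSol H H' (isMollifier_moll N) (isMollifier_moll N) hF hF₁ hF₂ hT).symm

theorem memLp_gradient (H : IsWeakSolution c₀ c h J)
    (H' : IsWeakSolution c₀' c' h' J') (hΦ₁ : Continuous Φ₁) (hΦ₂ : Continuous Φ₂) (hT : 0 < T)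
    (k : Fin 3) : MemLp (fun p => Φ₁ (c p, c' p) * h k p + Φ₂ (c p, c' p) * h' k p) 2
      ((volume.restrict (Ioo 0 T)).prod volume) :=
  (tendstoL2_gradient H H' hΦ₁ hΦ₂ hT k).memLp_lim

/-- The chain rule for functions of two weak solutions. -/
theorem integral_comp_mul_spaceGrad (H : IsWeakSolution c₀ c h J)
    (H' : IsWeakSolution c₀' c' h' J') (hΦ : HasPartials Φ Φ₁ Φ₂) {φ : ℝ × T3 → ℝ}
    (hφ : IsTestFunction φ) (k : Fin 3) :
    ∫ p in cyl, Φ (c p, c' p) * spaceGrad φ p k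
      = -∫ p in cyl, (Φ₁ (c p, c' p) * h k p + Φ₂ (c p, c' p) * h' k p) * φ p := by
  obtain ⟨T, hT, hs, hs'⟩ := hφ.exists_timeSupp
  have hc := continuous_of_lift hφ.smooth_lift.continuous
  have hc' := continuous_spaceGrad hφ.smooth_lift k
  rw [((hs' k).mul_left _).integral_cyl_eq, (hs.mul_left _).integral_cyl_eq,
    volume_restrict_cylUpTo]
  have t1 : TendstoL2 ((volume.restrict (Ioo 0 T)).prod volume) (fun _ p => spaceGrad φ p k)
      (fun p => spaceGrad φ p k) := TendstoL2.const ((hs' k).memLp hc' T)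
  have t2 : TendstoL2 ((volume.restrict (Ioo 0 T)).prod volume) (fun _ => φ) φ :=
    TendstoL2.const (hs.memLp hc T)
  have t3 : TendstoL2 ((volume.restrict (Ioo 0 T)).prod (volume : Measure T3))
      (fun _ _ => (1 : ℝ)) (fun _ => 1) := TendstoL2.const (memLp_const 1)
  have l1 := (tendstoL2_comp_stconv_mul H H' hΦ.continuous hT t1).tendsto_integral_mul t3
  have l2 := ((tendstoL2_gradient H H' hΦ.continuous_fst hΦ.continuous_snd hT
    k).tendsto_integral_mul t2).neg
  simp only [mul_one] at l1
  refine tendsto_nhds_unique l1 (l2.congr fun N => ?_)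
  exact (integral_comp_stconv_mul_deriv H H' (isMollifier_moll N) (isMollifier_moll N) hΦ hT
    (hs.memLp hc T) (((hs' k).memLp hc' T).integrable one_le_two)
    (Eventually.of_forall fun t => ⟨by fun_prop,
      hc'.comp (Continuous.prodMk_right t),
      hasTorusDeriv_spaceGrad hφ.smooth_lift k t⟩)).symm

theorem locallyIntegrableOn_of_memLp {E : Type*} [NormedAddCommGroup E] {f : ℝ × T3 → E}
    (hf : ∀ T > 0, MemLp f 2 ((volume.restrict (Ioo 0 T)).prod volume)) :
    LocallyIntegrableOn f cyl := by
  intro p hp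
  have h1 : 0 < p.1 + 1 := by linarith [mem_Ioi.1 hp.1]
  refine ⟨cylUpTo (p.1 + 1), mem_nhdsWithin_of_mem_nhds
    (prod_mem_nhds (Ioo_mem_nhds hp.1 (by linarith)) univ_mem), ?_⟩
  rw [IntegrableOn, volume_restrict_cylUpTo]
  exact (hf _ h1).integrable one_le_two

theorem memLp_toLp {μ : Measure (ℝ × T3)} {f : Fin 3 → ℝ × T3 → ℝ} (hf : ∀ k, MemLp (f k) 2 μ) :
    MemLp (fun p => (WithLp.toLp 2 fun k => f k p : E3)) 2 μ := by
  have h1 : ∀ p, (WithLp.toLp 2 fun k => f k p : E3)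
      = ∑ k, f k p • EuclideanSpace.single k (1 : ℝ) := by
    intro p
    ext i
    simp [Pi.single_apply]
  simp only [h1]
  exact memLp_finsetSum _ fun k _ => (ContinuousLinearMap.smulRight (1 : ℝ →L[ℝ] ℝ)
    (EuclideanSpace.single k (1 : ℝ) : E3)).comp_memLp' (hf k)

/-- Equality almost everywhere is all that is asked of `f`, so that `β`, given on `[0, ∞)`, may be
exchanged for an extension and the concentrations for `[0,1]`-valued representatives. -/
theorem isWeakGrad_comp (H : IsWeakSolution c₀ c h J)
    (H' : IsWeakSolution c₀' c' h' J') (hΦ : HasPartials Φ Φ₁ Φ₂) {f : ℝ × T3 → ℝ}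
    (hf : ∀ᵐ p ∂(volume.restrict cyl), f p = Φ (c p, c' p)) :
    IsWeakGrad f (fun p => WithLp.toLp 2 fun k =>
      Φ₁ (c p, c' p) * h k p + Φ₂ (c p, c' p) * h' k p) where
  locInt := by
    refine locallyIntegrableOn_of_memLp fun T hT => ?_
    rw [← volume_restrict_cylUpTo]
    have h1 := (tendstoL2_comp_stconv_mul H H' hΦ.continuous hT
      (TendstoL2.const (memLp_const (1 : ℝ)))).memLp_lim
    simp only [mul_one] at h1
    rw [← volume_restrict_cylUpTo] at h1
    exact h1.ae_eq ((ae_restrict_of_ae_restrict_of_subset (cylUpTo_subset_cyl T) hf).mono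
      fun p hp => hp.symm)
  locInt_grad := locallyIntegrableOn_of_memLp fun T hT => memLp_toLp fun k =>
    memLp_gradient H H' hΦ.continuous_fst hΦ.continuous_snd hT k
  integral_eq φ hφ _ k := by
    refine Eq.trans (integral_congr_ae ?_) (integral_comp_mul_spaceGrad H H' hΦ hφ k)
    filter_upwards [hf] with p hp
    rw [hp]

end Pair

/-! ### Calculus of functions of two variables -/

namespace HasPartials

variable {Φ Φ₁ Φ₂ Ψ Ψ₁ Ψ₂ : ℝ × ℝ → ℝ}

theorem comp_fst {b b' : ℝ → ℝ} (hb : ∀ s, HasDerivAt b (b' s) s) (hb' : Continuous b') :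
    HasPartials (fun z => b z.1) (fun z => b' z.1) (fun _ => 0) where
  hasFDerivAt z := by
    refine ((hb z.1).comp_hasFDerivAt z hasFDerivAt_fst).congr_fderiv ?_
    simp
  continuous_fst := by fun_prop
  continuous_snd := by fun_prop

theorem comp_snd {b b' : ℝ → ℝ} (hb : ∀ s, HasDerivAt b (b' s) s) (hb' : Continuous b') :
    HasPartials (fun z => b z.2) (fun _ => 0) (fun z => b' z.2) where
  hasFDerivAt z := by
    refine ((hb z.2).comp_hasFDerivAt z hasFDerivAt_snd).congr_fderiv ?_
    simp
  continuous_fst := by fun_prop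
  continuous_snd := by fun_prop

theorem sub (h : HasPartials Φ Φ₁ Φ₂) (h' : HasPartials Ψ Ψ₁ Ψ₂) :
    HasPartials (fun z => Φ z - Ψ z) (fun z => Φ₁ z - Ψ₁ z) (fun z => Φ₂ z - Ψ₂ z) where
  hasFDerivAt z := by
    refine ((h.hasFDerivAt z).sub (h'.hasFDerivAt z)).congr_fderiv ?_
    ext <;> simp
  continuous_fst := h.continuous_fst.sub h'.continuous_fst
  continuous_snd := h.continuous_snd.sub h'.continuous_snd

theorem add (h : HasPartials Φ Φ₁ Φ₂) (h' : HasPartials Ψ Ψ₁ Ψ₂) :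
    HasPartials (fun z => Φ z + Ψ z) (fun z => Φ₁ z + Ψ₁ z) (fun z => Φ₂ z + Ψ₂ z) where
  hasFDerivAt z := by
    refine ((h.hasFDerivAt z).add (h'.hasFDerivAt z)).congr_fderiv ?_
    ext <;> simp
  continuous_fst := h.continuous_fst.add h'.continuous_fst
  continuous_snd := h.continuous_snd.add h'.continuous_snd

theorem neg (h : HasPartials Φ Φ₁ Φ₂) :
    HasPartials (fun z => -Φ z) (fun z => -Φ₁ z) (fun z => -Φ₂ z) where
  hasFDerivAt z := by
    refine (h.hasFDerivAt z).neg.congr_fderiv ?_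
    ext <;> simp
  continuous_fst := h.continuous_fst.neg
  continuous_snd := h.continuous_snd.neg

theorem mul (h : HasPartials Φ Φ₁ Φ₂) (h' : HasPartials Ψ Ψ₁ Ψ₂) :
    HasPartials (fun z => Φ z * Ψ z) (fun z => Φ₁ z * Ψ z + Φ z * Ψ₁ z)
      (fun z => Φ₂ z * Ψ z + Φ z * Ψ₂ z) where
  hasFDerivAt z := by
    refine ((h.hasFDerivAt z).mul (h'.hasFDerivAt z)).congr_fderiv ?_
    ext <;> simp <;> ring
  continuous_fst := (h.continuous_fst.mul h'.continuous).add (h.continuous.mul h'.continuous_fst)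
  continuous_snd := (h.continuous_snd.mul h'.continuous).add (h.continuous.mul h'.continuous_snd)

theorem congr (h : HasPartials Φ Φ₁ Φ₂) (h₁ : ∀ z, Φ₁ z = Ψ₁ z) (h₂ : ∀ z, Φ₂ z = Ψ₂ z) :
    HasPartials Φ Ψ₁ Ψ₂ := by
  rwa [← funext h₁, ← funext h₂]

end HasPartials

/-- A twice continuously differentiable function on `[0, ∞)` extends to `ℝ`. -/
theorem exists_extension {β : ℝ → ℝ} (hβ : ContDiffOn ℝ 2 β (Ici 0)) :
    ∃ b₀ b₁ b₂ : ℝ → ℝ, (∀ s, HasDerivAt b₀ (b₁ s) s) ∧ (∀ s, HasDerivAt b₁ (b₂ s) s) ∧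
      Continuous b₂ ∧ ∀ s, 0 ≤ s → β s = b₀ s ∧ derivWithin β (Ici 0) s = b₁ s := by
  have hu : UniqueDiffOn ℝ (Ici (0 : ℝ)) := uniqueDiffOn_Ici 0
  have ftc : ∀ {f f' : ℝ → ℝ}, ContinuousOn f (Ici 0) →
      (∀ x > 0, HasDerivAt f (f' x) x) → Continuous f' →
      ∀ s, 0 ≤ s → f s = f 0 + ∫ r in (0 : ℝ)..s, f' r := by
    intro f f' hf hd hf' s hs
    rw [intervalIntegral.integral_eq_sub_of_hasDeriv_right_of_le hs
      (hf.mono Icc_subset_Ici_self) (fun x hx => (hd x hx.1).hasDerivWithinAt)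
      (hf'.intervalIntegrable _ _)]
    ring
  have prim : ∀ {f : ℝ → ℝ} (a : ℝ), Continuous f → ∀ s,
      HasDerivAt (fun s => a + ∫ r in (0 : ℝ)..s, f r) (f s) s := fun {f} a hf s =>
    (intervalIntegral.integral_hasDerivAt_right (hf.intervalIntegrable _ _)
      (hf.stronglyMeasurableAtFilter _ _) hf.continuousAt).const_add a
  set β' := derivWithin β (Ici 0) with hβ'
  have hβ'1 : ContDiffOn ℝ 1 β' (Ici 0) := hβ.derivWithin hu (by norm_num)
  have hβ''0 : ContinuousOn (derivWithin β' (Ici 0)) (Ici 0) :=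
    hβ'1.continuousOn_derivWithin hu le_rfl
  have hd : ∀ {f : ℝ → ℝ}, DifferentiableOn ℝ f (Ici 0) → ∀ x > 0,
      HasDerivAt f (derivWithin f (Ici 0) x) x := fun {f} hf x hx =>
    ((hf x (le_of_lt hx)).hasDerivWithinAt).hasDerivAt (Ici_mem_nhds hx)
  have hext : ∀ {f : ℝ → ℝ}, ContinuousOn f (Ici 0) → Continuous fun s => f (max s 0) :=
    fun {f} hf => hf.comp_continuous (by fun_prop) fun s => mem_Ici.2 (le_max_right _ _)
  -- The second derivative is continued by its value at `0` and integrated twice; the fundamental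
  -- theorem of calculus gives agreement on `[0, ∞)`.
  set b₂ : ℝ → ℝ := fun s => derivWithin β' (Ici 0) (max s 0) with hb₂
  set b₁ : ℝ → ℝ := fun s => β' 0 + ∫ r in (0 : ℝ)..s, b₂ r with hb₁
  set b₀ : ℝ → ℝ := fun s => β 0 + ∫ r in (0 : ℝ)..s, b₁ r with hb₀
  have c₂ : Continuous b₂ := hext hβ''0
  have d₁ : ∀ s, HasDerivAt b₁ (b₂ s) s := prim _ c₂
  have c₁ : Continuous b₁ := continuous_iff_continuousAt.2 fun s => (d₁ s).continuousAt
  have e₁ : ∀ s, 0 ≤ s → β' s = b₁ s := ftc hβ'1.continuousOn (fun x hx => by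
    have := hd (hβ'1.differentiableOn one_ne_zero) x hx
    simpa only [hb₂, max_eq_left (le_of_lt hx)] using this) c₂
  refine ⟨b₀, b₁, b₂, prim _ c₁, d₁, c₂, fun s hs => ⟨?_, e₁ s hs⟩⟩
  refine ftc hβ.continuousOn (fun x hx => ?_) c₁ s hs
  rw [← e₁ x (le_of_lt hx)]
  exact hd (hβ.differentiableOn two_ne_zero) x hx

/-! ### From renormalized solutions to weak solutions -/

/-- The truncation of a real number to `[0, 1]`. -/
def clip (s : ℝ) : ℝ := max 0 (min 1 s)

theorem clip_mem (s : ℝ) : clip s ∈ Icc (0 : ℝ) 1 :=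
  ⟨le_max_left _ _, max_le zero_le_one (min_le_left _ _)⟩

theorem clip_eq {s : ℝ} (hs : s ∈ Icc (0 : ℝ) 1) : clip s = s := by
  rw [clip, min_eq_right hs.2, max_eq_right hs.1]

theorem continuous_clip : Continuous clip := by unfold clip; fun_prop

theorem IsInitialDatum.ae_mem {n : ℕ} {c₀ : Fin n → T3 → ℝ} (h : IsInitialDatum c₀) (i : Fin n) :
    ∀ᵐ x, c₀ i x ∈ Icc (0 : ℝ) 1 := by
  filter_upwards [ae_all_iff.2 h.nonneg, h.sum_eq_one] with x h1 h2
  refine ⟨h1 i, ?_⟩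
  rw [← h2]
  exact Finset.single_le_sum (fun j _ => h1 j) (Finset.mem_univ i)

theorem IsInitialDatum.exists_representative {n : ℕ} {c₀ : Fin n → T3 → ℝ}
    (h : IsInitialDatum c₀) (i : Fin n) : ∃ f : T3 → ℝ, StronglyMeasurable f ∧
      (∀ x, f x ∈ Icc (0 : ℝ) 1) ∧ ∀ᵐ x, f x = c₀ i x := by
  refine ⟨fun x => clip ((h.meas i).mk _ x),
    continuous_clip.comp_stronglyMeasurable (h.meas i).stronglyMeasurable_mk,
    fun x => clip_mem _, ?_⟩
  filter_upwards [(h.meas i).ae_eq_mk, h.ae_mem i] with x h1 h2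
  rw [← h1, clip_eq h2]

theorem cyl_eq_iUnion : cyl = ⋃ m : ℕ, cylUpTo (m + 1) := by
  ext p
  simp only [mem_prod, mem_Ioi, mem_univ, and_true, mem_iUnion, mem_Ioo]
  refine ⟨fun hp => ?_, fun ⟨m, hm⟩ => hm.1⟩
  obtain ⟨m, hm⟩ := exists_nat_gt p.1
  exact ⟨m, hp, by linarith⟩

theorem aestronglyMeasurable_cyl {E : Type*} [NormedAddCommGroup E] {f : ℝ × T3 → E}
    (hf : ∀ T > 0, AEStronglyMeasurable f (volume.restrict (cylUpTo T))) :
    AEStronglyMeasurable f (volume.restrict cyl) := by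
  rw [cyl_eq_iUnion, aestronglyMeasurable_iUnion_iff]
  exact fun m => hf _ (by positivity)

theorem exists_locL2 {f : ℝ × T3 → ℝ}
    (hf : ∀ T > 0, MemLp f 2 (volume.restrict (cylUpTo T))) :
    ∃ g, LocL2 g ∧ g =ᵐ[volume.restrict cyl] f := by
  have hm := aestronglyMeasurable_cyl fun T hT => (hf T hT).aestronglyMeasurable
  refine ⟨hm.mk f, ⟨hm.stronglyMeasurable_mk, fun T hT => ?_⟩, hm.ae_eq_mk.symm⟩
  rw [← volume_restrict_cylUpTo]
  exact (hf T hT).ae_eq (ae_restrict_of_ae_restrict_of_subset (cylUpTo_subset_cyl T) hm.ae_eq_mk)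

theorem derivWithin_id_Ici {s : ℝ} (hs : 0 ≤ s) : derivWithin (fun r : ℝ => r) (Ici 0) s = 1 :=
  derivWithin_id' s _ (uniqueDiffOn_Ici 0 s hs)

theorem iteratedDerivWithin_two_id_Ici {s : ℝ} (hs : 0 ≤ s) :
    iteratedDerivWithin 2 (fun r : ℝ => r) (Ici 0) s = 0 := by
  rw [iteratedDerivWithin_succ]
  have h1 : EqOn (iteratedDerivWithin 1 (fun r : ℝ => r) (Ici 0)) (fun _ => 1) (Ici 0) := by
    intro r hr
    rw [iteratedDerivWithin_one]
    exact derivWithin_id_Ici hr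
  rw [derivWithin_congr h1 (h1 hs)]
  simp

namespace IsRenormalizedSolutionWith

variable {n : ℕ} {D : Fin n → Fin n → ℝ} {c₀ : Fin n → T3 → ℝ} {c : Fin n → ℝ × T3 → ℝ}
  {u g : Fin n → ℝ × T3 → E3}

theorem ae_mem (H : IsRenormalizedSolutionWith D c₀ c u g) (i : Fin n) :
    ∀ᵐ p ∂(volume.restrict cyl), c i p ∈ Icc (0 : ℝ) 1 := H.bounds i

theorem memLp_smul (H : IsRenormalizedSolutionWith D c₀ c u g) (i : Fin n) {T : ℝ}
    {v : ℝ × T3 → E3} (hv : MemLp v 2 (volume.restrict (cylUpTo T))) :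
    MemLp (fun p => c i p • v p) 2 (volume.restrict (cylUpTo T)) := by
  have hm : AEStronglyMeasurable (c i) (volume.restrict (cylUpTo T)) :=
    (H.meas i).mono_measure (Measure.restrict_mono (cylUpTo_subset_cyl T) le_rfl)
  refine MemLp.of_le_mul (c := 1) hv (hm.smul hv.aestronglyMeasurable) ?_
  filter_upwards [ae_restrict_of_ae_restrict_of_subset (cylUpTo_subset_cyl T) (H.bounds i)]
    with p hp
  rw [norm_smul, Real.norm_eq_abs, abs_of_nonneg hp.1]
  exact mul_le_mul_of_nonneg_right hp.2 (norm_nonneg _)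

/-- The flux is `√c` times `√c u`, and `√c ≤ 1`. -/
theorem memLp_flux (H : IsRenormalizedSolutionWith D c₀ c u g) (i : Fin n) {T : ℝ} (hT : 0 < T) :
    MemLp (fun p => c i p • u i p) 2 (volume.restrict (cylUpTo T)) := by
  have hm : AEStronglyMeasurable (c i) (volume.restrict (cylUpTo T)) :=
    (H.meas i).mono_measure (Measure.restrict_mono (cylUpTo_subset_cyl T) le_rfl)
  have hv := H.sqrt_vel_L2 i T hT
  have hb := ae_restrict_of_ae_restrict_of_subset (cylUpTo_subset_cyl T) (H.bounds i)
  have h1 : MemLp (fun p => √(c i p) • (√(c i p) • u i p)) 2 (volume.restrict (cylUpTo T)) := by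
    refine MemLp.of_le_mul (c := 1) hv
      ((Real.continuous_sqrt.comp_aestronglyMeasurable hm).smul hv.aestronglyMeasurable) ?_
    filter_upwards [hb] with p hp
    rw [norm_smul, Real.norm_eq_abs, abs_of_nonneg (Real.sqrt_nonneg _)]
    exact mul_le_mul_of_nonneg_right (Real.sqrt_le_one.2 hp.2) (norm_nonneg _)
  refine h1.ae_eq ?_
  filter_upwards [hb] with p hp
  rw [smul_smul, Real.mul_self_sqrt hp.1]

theorem memLp_apply {μ : Measure (ℝ × T3)} {v : ℝ × T3 → E3} (hv : MemLp v 2 μ) (k : Fin 3) :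
    MemLp (fun p => v p k) 2 μ :=
  (EuclideanSpace.proj (𝕜 := ℝ) k : E3 →L[ℝ] ℝ).comp_memLp' hv

/-- Every concentration of a renormalized solution is a weak solution of a transport equation. -/
theorem exists_isWeakSolution (H : IsRenormalizedSolutionWith D c₀ c u g) (i : Fin n)
    {f₀ : T3 → ℝ} (hm : StronglyMeasurable f₀) (hmem : ∀ x, f₀ x ∈ Icc (0 : ℝ) 1)
    (hf₀ : ∀ᵐ x, f₀ x = c₀ i x) :
    ∃ (f : ℝ × T3 → ℝ) (h J : Fin 3 → ℝ × T3 → ℝ), IsWeakSolution f₀ f h J ∧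
      (∀ᵐ p ∂(volume.restrict cyl), f p = c i p) ∧
      ∀ᵐ p ∂(volume.restrict cyl), ∀ k, J k p = (c i p • u i p) k := by
  -- The force-flux relation expresses the gradient by products of bounded concentrations and square
  -- integrable fluxes, so it is itself square integrable.
  have hV : ∀ T > 0, MemLp (fun p => - ∑ j ∈ Finset.univ.erase i,
      (D i j)⁻¹ • (c j p • (c i p • u i p) - c i p • (c j p • u j p))) 2
      (volume.restrict (cylUpTo T)) := fun T hT =>
    (memLp_finsetSum _ fun j _ => ((H.memLp_smul j (H.memLp_flux i hT)).sub
      (H.memLp_smul i (H.memLp_flux j hT))).const_smul (D i j)⁻¹).neg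
  choose h hh hhe using fun k : Fin 3 => exists_locL2 fun T hT => memLp_apply (hV T hT) k
  choose J hJ hJe using fun k : Fin 3 => exists_locL2 fun T hT => memLp_apply (H.memLp_flux i hT) k
  have hfe : ∀ᵐ p ∂(volume.restrict cyl), clip ((H.meas i).mk _ p) = c i p := by
    filter_upwards [(H.meas i).ae_eq_mk, H.ae_mem i] with p h1 h2
    rw [← h1, clip_eq h2]
  refine ⟨fun p => clip ((H.meas i).mk _ p), h, J, ?_, hfe, ae_all_iff.2 hJe⟩
  refine ⟨hm, hmem, continuous_clip.comp_stronglyMeasurable (H.meas i).stronglyMeasurable_mk,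
    fun p => clip_mem _, hh, hJ, fun φ hφ hs k => ?_, fun φ hφ => ?_⟩
  · refine Eq.trans (integral_congr_ae ?_) (((H.force_flux i).integral_eq φ hφ hs k).trans
      (congrArg Neg.neg (integral_congr_ae ?_)))
    · filter_upwards [hfe] with p hp
      rw [hp]
    · filter_upwards [hhe k] with p hp
      rw [hp]
  -- For `β(s) = s` the term with `β''` disappears and the renormalized equation becomes the
  -- transport equation.
  · have key := H.renormalized i (fun s => s) contDiffOn_id φ hφ
    obtain ⟨T, hT, -, hs⟩ := hφ.exists_timeSupp
    have hi := fun k => (hJ k).integrableOn_mul hT (hs k) (continuous_spaceGrad hφ.smooth_lift k)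
    rw [← integral_finsetSum _ fun k _ => hi k]
    have e1 : ∫ p in cyl, √(c i p) * derivWithin (fun s : ℝ => s) (Ici 0) (c i p)
        * inner ℝ (√(c i p) • u i p) (spaceGrad φ p)
        = ∫ p in cyl, ∑ k, J k p * spaceGrad φ p k := by
      refine integral_congr_ae ?_
      filter_upwards [H.ae_mem i, ae_all_iff.2 hJe] with p h1 h2
      rw [derivWithin_id_Ici h1.1, mul_one, ← real_inner_smul_left, smul_smul,
        Real.mul_self_sqrt h1.1, PiLp.inner_apply]
      refine Finset.sum_congr rfl fun k _ => ?_
      rw [h2 k]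
      simp [mul_comm]
    have e2 : ∫ p in cyl, c i p * iteratedDerivWithin 2 (fun s : ℝ => s) (Ici 0) (c i p)
        * inner ℝ (g i p) (√(c i p) • u i p) * φ p = 0 := by
      refine integral_eq_zero_of_ae ?_
      filter_upwards [H.ae_mem i] with p h1
      rw [iteratedDerivWithin_two_id_Ici h1.1]
      simp
    rw [e1, e2, mul_zero, add_zero] at key
    have e3 : ∫ x, f₀ x * φ (0, x) = ∫ x, c₀ i x * φ (0, x) :=
      integral_congr_ae (hf₀.mono fun x hx => by simp only [hx])
    have e4 : ∫ p in cyl, clip ((H.meas i).mk _ p) * timeDeriv φ p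
        = ∫ p in cyl, c i p * timeDeriv φ p :=
      integral_congr_ae (hfe.mono fun p hp => by simp only [hp])
    rw [e3, e4]
    exact key

end IsRenormalizedSolutionWith

/-! ### Consequences for a single species -/

theorem IsContinuousVersion.congr {f f' : ℝ × T3 → ℝ} {F : ℝ → Lp ℝ 2 (volume : Measure T3)}
    (hF : IsContinuousVersion f F) (h : ∀ᵐ p ∂(volume.restrict cyl), f p = f' p) :
    IsContinuousVersion f' F := by
  refine ⟨hF.1, ?_⟩
  rw [volume_restrict_cyl] at h
  filter_upwards [hF.2, Measure.ae_ae_of_ae_prod h] with t h1 h2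
  filter_upwards [h1, h2] with x h3 h4
  rw [h3, h4]

/-- Agreement at almost every time extends to all times by continuity. Hence the values at time `T`
do not depend on the choice of version. -/
theorem IsContinuousVersion.eqOn {f : ℝ × T3 → ℝ} {F G : ℝ → Lp ℝ 2 (volume : Measure T3)}
    (hF : IsContinuousVersion f F) (hG : IsContinuousVersion f G) : EqOn F G (Ici 0) := by
  refine Measure.eqOn_of_ae_eq (μ := volume) ?_ hF.1 hG.1 (by rw [interior_Ici, closure_Ioi])
  rw [← Measure.restrict_congr_set Ioi_ae_eq_Ici]
  filter_upwards [hF.2, hG.2] with t h1 h2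
  refine Lp.ext ?_
  filter_upwards [h1, h2] with x h3 h4
  rw [h3, h4]

section Pair

variable {c₀ : T3 → ℝ} {c c' : ℝ × T3 → ℝ} {h J h' J' : Fin 3 → ℝ × T3 → ℝ}
  {b₀ b₁ b₂ : ℝ → ℝ}

/-- These are the functions whose weak gradients are `G`, `K` and `Kbar`. The partial derivatives of
`(b₀ a - b₀ b) (a - b)` are the second plus the first, and minus the sum of the third and the first.
-/
theorem hasPartials_energy (d₀ : ∀ s, HasDerivAt b₀ (b₁ s) s) (d₁ : ∀ s, HasDerivAt b₁ (b₂ s) s)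
    (hb₂ : Continuous b₂) :
    HasPartials (fun z => b₀ z.1 - b₀ z.2) (fun z => b₁ z.1) (fun z => -b₁ z.2) ∧
    HasPartials (fun z => (z.1 - z.2) * b₁ z.1)
      (fun z => b₁ z.1 + (z.1 - z.2) * b₂ z.1) (fun z => -b₁ z.1) ∧
    HasPartials (fun z => (z.1 - z.2) * b₁ z.2)
      (fun z => b₁ z.2) (fun z => -b₁ z.2 + (z.1 - z.2) * b₂ z.2) := by
  have hb₁ : Continuous b₁ := continuous_iff_continuousAt.2 fun s => (d₁ s).continuousAt
  have hid : ∀ s : ℝ, HasDerivAt (fun r : ℝ => r) ((fun _ => (1 : ℝ)) s) s := fun s => hasDerivAt_id s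
  have hd : HasPartials (fun z => z.1 - z.2) (fun _ => 1) (fun _ => -1) :=
    ((HasPartials.comp_fst hid continuous_const).sub
      (HasPartials.comp_snd hid continuous_const)).congr (by simp) (by simp)
  refine ⟨?_, ?_, ?_⟩
  · exact ((HasPartials.comp_fst d₀ hb₁).sub (HasPartials.comp_snd d₀ hb₁)).congr
      (by simp) (by simp)
  · exact (hd.mul (HasPartials.comp_fst d₁ hb₂)).congr (by simp) (by simp)
  · exact (hd.mul (HasPartials.comp_snd d₁ hb₂)).congr (by simp) (by simp)

/-- The identity of the theorem for a single species. -/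
theorem energy_species (H : IsWeakSolution c₀ c h J) (H' : IsWeakSolution c₀ c' h' J')
    (d₀ : ∀ s, HasDerivAt b₀ (b₁ s) s) (d₁ : ∀ s, HasDerivAt b₁ (b₂ s) s)
    (hb₂ : Continuous b₂) {T : ℝ} (hT : 0 < T) {a b : T3 → ℝ}
    (ha : TendstoL2 volume (fun N => mollSol (moll N) c₀ J T) a)
    (hb : TendstoL2 volume (fun N => mollSol (moll N) c₀ J' T) b) :
    ∫ x, (b₀ (a x) - b₀ (b x)) * (a x - b x)
      = ∑ k, ∫ p in cylUpTo T,
        ((b₁ (c p) * h k p + (-b₁ (c' p)) * h' k p) * (J k p - J' k p)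
          + (((b₁ (c p) + (c p - c' p) * b₂ (c p)) * h k p + (-b₁ (c p)) * h' k p) * J k p
            - (b₁ (c' p) * h k p + (-b₁ (c' p) + (c p - c' p) * b₂ (c' p)) * h' k p)
              * J' k p)) := by
  have hb₁ : Continuous b₁ := continuous_iff_continuousAt.2 fun s => (d₁ s).continuousAt
  obtain ⟨hG, hK, hK'⟩ := hasPartials_energy d₀ d₁ hb₂
  have hid : ∀ s : ℝ, HasDerivAt (fun r : ℝ => r) ((fun _ => (1 : ℝ)) s) s := fun s => hasDerivAt_id s
  have hd : HasPartials (fun z => z.1 - z.2) (fun _ => 1) (fun _ => -1) :=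
    ((HasPartials.comp_fst hid continuous_const).sub
      (HasPartials.comp_snd hid continuous_const)).congr (by simp) (by simp)
  have hF : HasPartials (fun z => (b₀ z.1 - b₀ z.2) * (z.1 - z.2))
      (fun z => (z.1 - z.2) * b₁ z.1 + (b₀ z.1 - b₀ z.2))
      (fun z => -((z.1 - z.2) * b₁ z.2 + (b₀ z.1 - b₀ z.2))) :=
    (hG.mul hd).congr (fun z => by ring) (fun z => by ring)
  have key := energy_weakSolution H H' hF (hK.add hG) (hK'.add hG).neg hT ha hb
  -- The initial term is the energy density on the diagonal `(c₀, c₀)`, where it is zero.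
  simp only [sub_self, mul_zero, integral_zero, zero_add] at key
  rw [key]
  refine Finset.sum_congr rfl fun k _ => ?_
  rw [volume_restrict_cylUpTo]
  have i1 := (memLp_gradient H H' (hK.add hG).continuous_fst (hK.add hG).continuous_snd hT
    k).integrable_mul ((H.locL2_flux k).memLp T hT)
  have i2 := (memLp_gradient H H' (hK'.add hG).neg.continuous_fst (hK'.add hG).neg.continuous_snd
    hT k).integrable_mul ((H'.locL2_flux k).memLp T hT)
  -- Regrouping `(K + G) J - (K' + G) J'` as `G (J - J') + (K J - K' J')`.
  refine (integral_add i1 i2).symm.trans (integral_congr_ae (Eventually.of_forall fun p => ?_))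
  simp only [Pi.mul_apply]
  ring

end Pair

theorem inner_toLp (v : Fin 3 → ℝ) (w : E3) :
    inner ℝ (WithLp.toLp 2 v : E3) w = ∑ k, v k * w k := by
  rw [PiLp.inner_apply]
  exact Finset.sum_congr rfl fun k _ => by simp [mul_comm]

/-- The theorem for one species. The other species matter only through the square integrability of
the gradient, so no cancellation in the sum over species is needed. -/
theorem exists_gradients_species {n : ℕ} {D : Fin n → Fin n → ℝ} {c₀ : Fin n → T3 → ℝ}
    (hc₀ : IsInitialDatum c₀) {c cbar : Fin n → ℝ × T3 → ℝ} {u ubar g gbar : Fin n → ℝ × T3 → E3}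
    (R : IsRenormalizedSolutionWith D c₀ c u g)
    (Rbar : IsRenormalizedSolutionWith D c₀ cbar ubar gbar) (i : Fin n) :
    (∃ F, IsContinuousVersion (c i) F) ∧ (∃ F, IsContinuousVersion (cbar i) F) ∧
    ∀ C Cbar : ℝ → Lp ℝ 2 (volume : Measure T3),
      IsContinuousVersion (c i) C → IsContinuousVersion (cbar i) Cbar →
      ∀ β : ℝ → ℝ, ContDiffOn ℝ 2 β (Ici 0) →
      ∃ G K Kbar : ℝ × T3 → E3,
        IsWeakGrad (fun p => β (c i p) - β (cbar i p)) G ∧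
        IsWeakGrad (fun p => (c i p - cbar i p) * derivWithin β (Ici 0) (c i p)) K ∧
        IsWeakGrad (fun p => (c i p - cbar i p) * derivWithin β (Ici 0) (cbar i p)) Kbar ∧
        ∀ T : ℝ, 0 < T →
          Integrable (fun x => (β (C T x) - β (Cbar T x)) * (C T x - Cbar T x)) volume ∧
          IntegrableOn (fun p => inner ℝ (G p) (c i p • u i p - cbar i p • ubar i p))
            (cylUpTo T) volume ∧
          IntegrableOn (fun p => inner ℝ (K p) (c i p • u i p)
            - inner ℝ (Kbar p) (cbar i p • ubar i p)) (cylUpTo T) volume ∧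
          ∫ x, (β (C T x) - β (Cbar T x)) * (C T x - Cbar T x)
            = (∫ p in cylUpTo T, inner ℝ (G p) (c i p • u i p - cbar i p • ubar i p))
              + ∫ p in cylUpTo T, (inner ℝ (K p) (c i p • u i p)
                  - inner ℝ (Kbar p) (cbar i p • ubar i p)) := by
  -- One representative of the initial datum serves both solutions, so that the initial term cancels
  -- pointwise.
  obtain ⟨f₀, hm, hmem, hf₀⟩ := hc₀.exists_representative i
  obtain ⟨f, h, J, H, hf, hJ⟩ := R.exists_isWeakSolution i hm hmem hf₀
  obtain ⟨f', h', J', H', hf', hJ'⟩ := Rbar.exists_isWeakSolution i hm hmem hf₀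
  obtain ⟨F, hF, hFt⟩ := H.exists_continuousVersion
  obtain ⟨F', hF', hFt'⟩ := H'.exists_continuousVersion
  refine ⟨⟨F, hF.congr hf⟩, ⟨F', hF'.congr hf'⟩, fun C Cbar hC hCbar β hβ => ?_⟩
  obtain ⟨b₀, b₁, b₂, d₀, d₁, hb₂, hb⟩ := exists_extension hβ
  obtain ⟨hG, hK, hK'⟩ := hasPartials_energy d₀ d₁ hb₂
  refine ⟨_, _, _, isWeakGrad_comp H H' hG ?_, isWeakGrad_comp H H' hK ?_,
    isWeakGrad_comp H H' hK' ?_, fun T hT => ?_⟩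
  · filter_upwards [hf, hf'] with p h1 h2
    rw [← h1, ← h2, (hb _ (H.mem p).1).1, (hb _ (H'.mem p).1).1]
  · filter_upwards [hf, hf'] with p h1 h2
    rw [← h1, ← h2, (hb _ (H.mem p).1).2]
  · filter_upwards [hf, hf'] with p h1 h2
    rw [← h1, ← h2, (hb _ (H'.mem p).1).2]
  -- The given versions are replaced by the constructed ones, which are known to be limits of
  -- mollifications at time `T`.
  have hCF : C T = F T := hC.eqOn (hF.congr hf) hT.le
  have hCF' : Cbar T = F' T := hCbar.eqOn (hF'.congr hf') hT.le
  have m1 := (hFt T hT).mem_Icc fun N => Eventually.of_forall fun x =>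
    H.mollSol_mem (isMollifier_moll N) hT.le x
  have m2 := (hFt' T hT).mem_Icc fun N => Eventually.of_forall fun x =>
    H'.mollSol_mem (isMollifier_moll N) hT.le x
  have hβb : ∀ᵐ x : T3, (β (C T x) - β (Cbar T x)) * (C T x - Cbar T x)
      = (b₀ (F T x) - b₀ (F' T x)) * (F T x - F' T x) := by
    filter_upwards [m1, m2] with x h1 h2
    rw [hCF, hCF', (hb _ h1.1).1, (hb _ h2.1).1]
  have hJT := ae_restrict_of_ae_restrict_of_subset (cylUpTo_subset_cyl T) hJ
  have hJT' := ae_restrict_of_ae_restrict_of_subset (cylUpTo_subset_cyl T) hJ'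
  have j1 := fun k => (H.locL2_flux k).memLp T hT
  have j2 := fun k => (H'.locL2_flux k).memLp T hT
  have gG := fun k => memLp_gradient H H' hG.continuous_fst hG.continuous_snd hT k
  have gK := fun k => memLp_gradient H H' hK.continuous_fst hK.continuous_snd hT k
  have gK' := fun k => memLp_gradient H H' hK'.continuous_fst hK'.continuous_snd hT k
  rw [← volume_restrict_cylUpTo] at j1 j2 gG gK gK'
  have i1 : ∀ k, Integrable (fun p => (b₁ (f p) * h k p + (-b₁ (f' p)) * h' k p)
      * (J k p - J' k p)) (volume.restrict (cylUpTo T)) :=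
    fun k => (gG k).integrable_mul ((j1 k).sub (j2 k))
  have i2 : ∀ k, Integrable (fun p =>
      ((b₁ (f p) + (f p - f' p) * b₂ (f p)) * h k p + (-b₁ (f p)) * h' k p) * J k p
        - (b₁ (f' p) * h k p + (-b₁ (f' p) + (f p - f' p) * b₂ (f' p)) * h' k p) * J' k p)
      (volume.restrict (cylUpTo T)) :=
    fun k => ((gK k).integrable_mul (j1 k)).sub ((gK' k).integrable_mul (j2 k))
  have e1 : ∀ᵐ p ∂(volume.restrict (cylUpTo T)), (∑ k, (b₁ (f p) * h k p + (-b₁ (f' p)) * h' k p)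
      * (J k p - J' k p)) = inner ℝ (WithLp.toLp 2 fun k =>
        b₁ (f p) * h k p + (-b₁ (f' p)) * h' k p : E3) (c i p • u i p - cbar i p • ubar i p) := by
    filter_upwards [hJT, hJT'] with p h1 h2
    rw [inner_toLp]
    exact Finset.sum_congr rfl fun k _ => by rw [h1 k, h2 k]; rfl
  have e2 : ∀ᵐ p ∂(volume.restrict (cylUpTo T)),
      (∑ k, ((((b₁ (f p) + (f p - f' p) * b₂ (f p)) * h k p + (-b₁ (f p)) * h' k p) * J k p
            - (b₁ (f' p) * h k p + (-b₁ (f' p) + (f p - f' p) * b₂ (f' p)) * h' k p)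
              * J' k p)))
      = inner ℝ (WithLp.toLp 2 fun k => (b₁ (f p) + (f p - f' p) * b₂ (f p)) * h k p
          + (-b₁ (f p)) * h' k p : E3) (c i p • u i p)
        - inner ℝ (WithLp.toLp 2 fun k => b₁ (f' p) * h k p
          + (-b₁ (f' p) + (f p - f' p) * b₂ (f' p)) * h' k p : E3) (cbar i p • ubar i p) := by
    filter_upwards [hJT, hJT'] with p h1 h2
    rw [inner_toLp, inner_toLp, ← Finset.sum_sub_distrib]
    exact Finset.sum_congr rfl fun k _ => by rw [h1 k, h2 k]
  have hb₀ := hG.continuous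
  refine ⟨?_, (integrable_finsetSum _ fun k _ => i1 k).congr e1,
    (integrable_finsetSum _ fun k _ => i2 k).congr e2, ?_⟩
  · have hint := (TendstoL2.comp_mul hb₀ (hFt T hT) (hFt' T hT)
      (TendstoL2.const (memLp_const (1 : ℝ)))
      (fun N => Eventually.of_forall fun x => H.mollSol_mem (isMollifier_moll N) hT.le x)
      (fun N => Eventually.of_forall fun x =>
        H'.mollSol_mem (isMollifier_moll N) hT.le x)).memLp_lim.integrable_mul
      ((hFt T hT).memLp_lim.sub (hFt' T hT).memLp_lim)
    refine hint.congr ?_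
    filter_upwards [hβb] with x hx
    rw [hx]
    simp
  · rw [integral_congr_ae hβb, energy_species H H' d₀ d₁ hb₂ hT (hFt T hT) (hFt' T hT),
      ← integral_congr_ae e1, ← integral_congr_ae e2, integral_finsetSum _ fun k _ => i1 k,
      integral_finsetSum _ fun k _ => i2 k, ← Finset.sum_add_distrib]
    exact Finset.sum_congr rfl fun k _ => integral_add (i1 k) (i2 k)

end MaxwellStefan

end

/-! ### Summation over the species. -/

theorem theorem2p3 {n : ℕ} (D : Fin n → Fin n → ℝ) (hD : IsDiffusionMatrix D)
    (c₀ : Fin n → T3 → ℝ) (hc₀ : IsInitialDatum c₀)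
    (c cbar : Fin n → ℝ × T3 → ℝ) (u ubar : Fin n → ℝ × T3 → E3)
    (hc : IsRenormalizedSolution D c₀ c u)
    (hcbar : IsRenormalizedSolution D c₀ cbar ubar) :
    (∀ i, ∃ F, IsContinuousVersion (c i) F) ∧
    (∀ i, ∃ F, IsContinuousVersion (cbar i) F) ∧
    ∀ C Cbar : Fin n → ℝ → Lp ℝ 2 (volume : Measure T3),
      (∀ i, IsContinuousVersion (c i) (C i)) →
      (∀ i, IsContinuousVersion (cbar i) (Cbar i)) →
      ∀ β : ℝ → ℝ, ContDiffOn ℝ 2 β (Ici 0) →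
      ∃ G K Kbar : Fin n → ℝ × T3 → E3,
        (∀ i, IsWeakGrad (fun p => β (c i p) - β (cbar i p)) (G i)) ∧
        (∀ i, IsWeakGrad
          (fun p => (c i p - cbar i p) * derivWithin β (Ici 0) (c i p)) (K i)) ∧
        (∀ i, IsWeakGrad
          (fun p => (c i p - cbar i p) * derivWithin β (Ici 0) (cbar i p)) (Kbar i)) ∧
        ∀ T : ℝ, 0 < T →
          (∀ i, Integrable
            (fun x => (β (C i T x) - β (Cbar i T x)) * (C i T x - Cbar i T x)) volume) ∧
          (∀ i, IntegrableOn
            (fun p => inner ℝ (G i p) (c i p • u i p - cbar i p • ubar i p))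
            (cylUpTo T) volume) ∧
          (∀ i, IntegrableOn
            (fun p => inner ℝ (K i p) (c i p • u i p)
              - inner ℝ (Kbar i p) (cbar i p • ubar i p))
            (cylUpTo T) volume) ∧
          ∑ i, ∫ x, (β (C i T x) - β (Cbar i T x)) * (C i T x - Cbar i T x)
            = ∑ i, (∫ p in cylUpTo T,
                inner ℝ (G i p) (c i p • u i p - cbar i p • ubar i p))
              + ∑ i, (∫ p in cylUpTo T,
                (inner ℝ (K i p) (c i p • u i p)
                  - inner ℝ (Kbar i p) (cbar i p • ubar i p))) := by
  obtain ⟨g, R⟩ := hc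
  obtain ⟨gbar, Rbar⟩ := hcbar
  have key := exists_gradients_species hc₀ R Rbar
  refine ⟨fun i => (key i).1, fun i => (key i).2.1, fun C Cbar hC hCbar β hβ => ?_⟩
  choose G K Kbar hG hK hKbar hT using fun i => (key i).2.2 (C i) (Cbar i) (hC i) (hCbar i) β hβ
  refine ⟨G, K, Kbar, hG, hK, hKbar, fun T hT0 => ⟨fun i => (hT i T hT0).1,
    fun i => (hT i T hT0).2.1, fun i => (hT i T hT0).2.2.1, ?_⟩⟩
  rw [← Finset.sum_add_distrib]
  exact Finset.sum_congr rfl fun i _ => (hT i T hT0).2.2.2
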